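/- For complex $q$ with $0<|q|<1$ let $$R(q)=\cfrac{q^{1/5}}{1+\cfrac{q}{1+\cfrac{q^2}{1+\cfrac{q^3}{1+\cdots}}}}$$ be the Rogers–Ramanujan continued fraction (it converges, to a nonzero value, for every choice of the fifth root $q^{1/5}$). Fix any fifth root $q^{1/5}$ of $q$, and evaluate $R(\pm q^n)$ below with the fifth roots $(q^n)^{1/5}=(q^{1/5})^n$ and $(-q^n)^{1/5}=-(q^{1/5})^n$. Then all denominators below are nonzero and $$\frac{R^2(q^4)}{R(q)R(q^2)}=R(q^{20})\,\frac{1-R(q^5)R(q^{10})-R(q^{20})}{R(q^5)R(q^{10})-R(q^{20})+R(q^5)R(q^{10})R(q^{20})},$$ $$\frac{R(q)}{R(-q)}=-\,\frac{1-R(q^5)-R(q^5)R(-q^5)}{1-R(-q^5)-R(q^5)R(-q^5)},$$ $$\frac{R(q^2)}{R(q)^2}-\frac{R(q)^2}{R(q^2)}=4\,\frac{D}{N},$$ where $$D=R(q^5)\left(1+R(q^5)R^2(q^{10})-R^2(q^5)R^4(q^{10})\right)$$ and $$\begin{aligned}N={}&1+R(q^5)+R^2(q^5)+2R(q^5)R(q^{10})+2R^2(q^5)R(q^{10})-2R(q^5)R^2(q^{10})\\&+2R^3(q^5)R^2(q^{10})-2R^2(q^5)R^3(q^{10})+2R^3(q^5)R^3(q^{10})+R^2(q^5)R^4(q^{10})\\&-R^3(q^5)R^4(q^{10})+R^4(q^5)R^4(q^{10}).\end{aligned}$$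 -/

import Mathlib

/-- The continued fraction `r/1 + q/1 + q^2/1 + q^3/1 + ⋯`, that is
`r / (1 + q / (1 + q^2 / (1 + q^3 / (1 + ⋯))))`: integer part `0`, partial numerators
`r, q, q^2, q^3, …` and all partial denominators equal to `1`. -/
noncomputable def rogersRamanujanFract (r q : ℂ) : GenContFract ℂ where
  h := 0
  s := Stream'.Seq.ofStream (fun n : ℕ => ⟨if n = 0 then r else q ^ n, 1⟩)

/-- The Rogers-Ramanujan continued fraction `R(q) = q^(1/5)/1 + q/1 + q^2/1 + ⋯`, where `r` is the
value chosen for the fifth root `q^(1/5)` (so it is meant for `r ^ 5 = q`): the limit of the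
convergents of the continued fraction. -/
noncomputable def rogersRamanujan (r q : ℂ) : ℂ :=
  Filter.limUnder Filter.atTop (fun n : ℕ => (rogersRamanujanFract r q).convs n)

/-! By the Rogers–Ramanujan identities `R(q) = q^(1/5) f(-q, -q^4) / f(-q^2, -q^3)`, with `f`
Ramanujan's theta function. To see this, let `F_m` be `rrSum q m`. It satisfies `F_m = F_(m+1) +
q^(m+1) F_(m+2)` and `F_m → 1`. Solving the three-term recurrence of the convergents against this
sequence gives the limit `q^(1/5) F_1 / F_0`. At `m = 0, 1` the series `F_m` folds into a two-sided
theta series, which the Jacobi triple product (`jacobi_triple_product`) turns into an infinite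
product.

The quintic identities come from evaluating one theta quotient twice. Write `φ(q) = ∑ q^(n^2)`,
which is `theta q 1`, and `2ψ(q^2) = ∑ q^(n^2+n)`, which is `theta q q`, both over all integers.
Product identities (`ramF_mul_ramF`) tie each modular quantity to a theta quotient of level 5: `z =
R(q)R(q^4)` satisfies `φ(q)(1 - z) = φ(q^5)(1 + z)`; `u = R(q)`, `w = R(-q)` satisfy `(u - w) q
ψ(q^10) = -(u + w) ψ(q^2)`; `k = R(q)R(q^2)^2` satisfies `k ψ(q)^2 = q (1 + k - k^2) ψ(q^5)^2`. On
the other hand, splitting `φ` or `ψ` by exponents modulo 5 (`theta_dissection_five`) writes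
`φ(q)/φ(q^25)`, or its analogue for `ψ`, rationally in the values of `R` at powers of `±q^5`. The
level-5 relation at `q^5` links `q^5` to `q^25`, and eliminating the thetas leaves
`mul_four_quintic`, `div_neg_quintic` and `mul_sq_quintic`.

The first claim is `mul_four_quintic` at `-q`, rewritten by `R(q)R(-q)R(q^2) = -R(q^4)`. The second
is `div_neg_quintic`. For the third, Rogers' equation gives `R(q^2)/R(q)^2 = (1 + k)/(1 - k)`, so
the left side is `4k/(1 - k^2)`, and `mul_sq_quintic` evaluates it. The nonvanishing of the
denominators follows from the same relations, because the products involved have no zeros. -/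

open Filter Topology

/-! ### Infinite `q`-Pochhammer products. -/

/-- The infinite `q`-Pochhammer symbol `(x; q)_∞`. -/
noncomputable def qPoch (x q : ℂ) : ℂ := ∏' n : ℕ, (1 - x * q ^ n)

theorem summable_norm_mul_pow (x : ℂ) {q : ℂ} (hq : ‖q‖ < 1) :
    Summable fun n : ℕ => ‖-(x * q ^ n)‖ := by
  simp only [norm_neg, norm_mul, norm_pow]
  exact (summable_geometric_of_lt_one (norm_nonneg _) hq).mul_left _

theorem multipliable_qPoch (x : ℂ) {q : ℂ} (hq : ‖q‖ < 1) :
    Multipliable fun n : ℕ => (1 - x * q ^ n) := by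
  simpa [sub_eq_add_neg] using multipliable_one_add_of_summable (summable_norm_mul_pow x hq)

theorem tendsto_qPoch (x : ℂ) {q : ℂ} (hq : ‖q‖ < 1) :
    Tendsto (fun N : ℕ => ∏ n ∈ Finset.range N, (1 - x * q ^ n)) atTop (𝓝 (qPoch x q)) :=
  (multipliable_qPoch x hq).hasProd.tendsto_prod_nat

theorem qPoch_ne_zero {x q : ℂ} (hq : ‖q‖ < 1) (h : ∀ n : ℕ, x * q ^ n ≠ 1) : qPoch x q ≠ 0 := by
  have := tprod_one_add_ne_zero_of_summable (f := fun n : ℕ => -(x * q ^ n))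
    (fun n hn => h n (by linear_combination -hn)) (summable_norm_mul_pow x hq)
  simpa [qPoch, sub_eq_add_neg] using this

theorem qPoch_ne_zero_of_norm_lt_one {x q : ℂ} (hq : ‖q‖ < 1) (hx : ‖x‖ < 1) :
    qPoch x q ≠ 0 := by
  refine qPoch_ne_zero hq fun n hn => ?_
  have h1 : ‖x * q ^ n‖ < 1 := by
    rw [norm_mul, norm_pow]
    exact (mul_le_of_le_one_right (norm_nonneg _) (pow_le_one₀ (norm_nonneg _) hq.le)).trans_lt hx
  rw [hn] at h1
  simp at h1

theorem qPoch_succ (x : ℂ) {q : ℂ} (hq : ‖q‖ < 1) : qPoch x q = (1 - x) * qPoch (x * q) q := by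
  refine tendsto_nhds_unique ((tendsto_add_atTop_iff_nat 1).2 (tendsto_qPoch x hq)) ?_
  refine ((tendsto_qPoch (x * q) hq).const_mul (1 - x)).congr fun N => ?_
  rw [Finset.prod_range_succ', mul_comm]
  simp [pow_succ', mul_assoc]

theorem qPoch_mul_neg (x : ℂ) {q : ℂ} (hq : ‖q‖ < 1) :
    qPoch x q * qPoch (-x) q = qPoch (x ^ 2) (q ^ 2) := by
  rw [qPoch, qPoch, ← (multipliable_qPoch x hq).tprod_mul (multipliable_qPoch (-x) hq), qPoch]
  congr 1; ext n; ring

/-- Sort the exponents by residue modulo `m`; multipliability permits the regrouping. -/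
theorem qPoch_split (x : ℂ) {q : ℂ} (hq : ‖q‖ < 1) (m : ℕ) [NeZero m] :
    qPoch x q = ∏ r : Fin m, qPoch (x * q ^ (r : ℕ)) (q ^ m) := by
  have hm := multipliable_qPoch x hq
  have hqm : ‖q ^ m‖ < 1 := by
    rw [norm_pow]; exact pow_lt_one₀ (norm_nonneg _) hq (NeZero.ne m)
  have e : ∀ c : ℕ × Fin m, (1 - x * q ^ ((Nat.divModEquiv m).symm c))
      = 1 - (x * q ^ (c.2 : ℕ)) * (q ^ m) ^ c.1 := by
    intro c
    rw [Nat.divModEquiv_symm_apply, pow_add, pow_mul, ← pow_mul, mul_comm c.1 m, pow_mul]; ring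
  have h2 := ((Nat.divModEquiv m).symm.multipliable_iff).2 hm
  simp only [Function.comp_def, e] at h2
  rw [qPoch, ← (Nat.divModEquiv m).symm.tprod_eq, tprod_congr e,
    ← (Equiv.prodComm (Fin m) ℕ).tprod_eq]
  refine (Multipliable.tprod_prod'
    (f := fun c : Fin m × ℕ => 1 - x * q ^ (c.1 : ℕ) * (q ^ m) ^ c.2)
    ((Equiv.prodComm (Fin m) ℕ).multipliable_iff.2 h2)
    (fun r => multipliable_qPoch (x * q ^ (r : ℕ)) hqm)).trans ?_
  rw [tprod_fintype]
  rfl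

/-! ### Theta series and the Jacobi triple product. -/

/-- The theta function `∑ p^(n^2) z^n`, summed over all integers. -/
noncomputable def theta (p z : ℂ) : ℂ := ∑' n : ℤ, p ^ (n * n) * z ^ n

theorem summable_pow_sq_mul_pow {p : ℂ} (hp : ‖p‖ < 1) (z : ℂ) :
    Summable fun n : ℕ => p ^ (n * n) * z ^ n := by
  -- The `n`-th term is the `n`-th power of `p ^ n * z`, whose norm is eventually at most `1 / 2`.
  have h : Tendsto (fun n : ℕ => ‖p‖ ^ n * ‖z‖) atTop (𝓝 0) := by
    simpa using (tendsto_pow_atTop_nhds_zero_of_lt_one (norm_nonneg _) hp).mul_const ‖z‖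
  have h2 : ∀ᶠ n : ℕ in atTop, ‖p‖ ^ n * ‖z‖ ≤ 1 / 2 :=
    h.eventually_le_const (by norm_num)
  refine Summable.of_norm_bounded_eventually_nat (g := fun n => (1 / 2 : ℝ) ^ n)
    (summable_geometric_of_lt_one (by norm_num) (by norm_num)) ?_
  filter_upwards [h2] with n hn
  rw [norm_mul, norm_pow, norm_pow, pow_mul, ← mul_pow]
  exact pow_le_pow_left₀ (by positivity) hn n

theorem summable_theta {p : ℂ} (hp : ‖p‖ < 1) (z : ℂ) :
    Summable fun n : ℤ => p ^ (n * n) * z ^ n := by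
  apply Summable.of_nat_of_neg
  · refine (summable_pow_sq_mul_pow hp z).congr fun n => ?_
    rw [zpow_natCast, ← Nat.cast_mul, zpow_natCast]
  · refine (summable_pow_sq_mul_pow hp z⁻¹).congr fun n => ?_
    rw [neg_mul_neg, zpow_neg, zpow_natCast, ← Nat.cast_mul, zpow_natCast, inv_pow]

/-- The Gaussian binomial coefficient, defined by the `q`-Pascal recursion. -/
noncomputable def gaussBinom (q : ℂ) : ℕ → ℕ → ℂ
  | _, 0 => 1
  | 0, _ + 1 => 0
  | M + 1, k + 1 => gaussBinom q M (k + 1) * q ^ (k + 1) + gaussBinom q M k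

theorem gaussBinom_eq_zero (q : ℂ) : ∀ {M k : ℕ}, M < k → gaussBinom q M k = 0
  | 0, k + 1, _ => by simp [gaussBinom]
  | M + 1, k + 1, h => by
    rw [gaussBinom, gaussBinom_eq_zero q (by omega : M < k + 1),
      gaussBinom_eq_zero q (by omega : M < k)]
    simp

theorem gaussBinom_zero_right (q : ℂ) (M : ℕ) : gaussBinom q M 0 = 1 := by
  cases M <;> simp [gaussBinom]

/-- The `q`-binomial theorem. Induction detaches the factor `i = 0`, leaving the shorter product at
`y * q`; matching coefficients is then the `q`-Pascal rule. This is why `y` is quantified inside. -/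
theorem prod_one_add_mul_pow (q : ℂ) (M : ℕ) : ∀ y : ℂ,
    ∏ i ∈ Finset.range M, (1 + y * q ^ i)
      = ∑ k ∈ Finset.range (M + 1), q ^ (k.choose 2) * gaussBinom q M k * y ^ k := by
  induction M with
  | zero => intro y; simp [gaussBinom]
  | succ M ih =>
    intro y
    rw [Finset.prod_range_succ']
    have h1 : ∏ k ∈ Finset.range M, (1 + y * q ^ (k + 1))
        = ∏ k ∈ Finset.range M, (1 + (y * q) * q ^ k) :=
      Finset.prod_congr rfl fun k _ => by ring
    have h2 : ∑ k ∈ Finset.range (M + 1), q ^ (k.choose 2) * gaussBinom q M k * (y * q) ^ k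
        = ∑ k ∈ Finset.range (M + 1),
            q ^ ((k + 1).choose 2) * (gaussBinom q M (k + 1) * q ^ (k + 1)) * y ^ (k + 1) + 1 := by
      have := Finset.sum_range_succ'
        (fun k => q ^ (k.choose 2) * gaussBinom q M k * (y * q) ^ k) (M + 1)
      rw [Finset.sum_range_succ, gaussBinom_eq_zero q (Nat.lt_succ_self M)] at this
      simp only [gaussBinom_zero_right, mul_zero, zero_mul, add_zero, pow_zero, mul_one] at this
      rw [this]
      simp only [Nat.choose_zero_succ, pow_zero]
      congr 1
      exact Finset.sum_congr rfl fun k _ => by ring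
    rw [h1, ih, Finset.sum_range_succ' _ (M + 1)]
    simp only [gaussBinom, pow_zero, mul_one, mul_add, add_mul,
      Finset.sum_add_distrib, Nat.choose_zero_succ]
    rw [h2]
    have h3 : ∑ k ∈ Finset.range (M + 1), q ^ ((k + 1).choose 2) * gaussBinom q M k * y ^ (k + 1)
        = y * ∑ k ∈ Finset.range (M + 1), q ^ (k.choose 2) * gaussBinom q M k * (y * q) ^ k := by
      rw [Finset.mul_sum]
      refine Finset.sum_congr rfl fun k _ => ?_
      rw [Nat.choose_succ_succ' k 1, Nat.choose_one_right]; ring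
    rw [h3, h2]; ring

/-- The finite `q`-Pochhammer symbol `(q; q)_n`. -/
noncomputable def qFact (q : ℂ) (n : ℕ) : ℂ := ∏ i ∈ Finset.range n, (1 - q ^ (i + 1))

theorem qFact_succ (q : ℂ) (n : ℕ) : qFact q (n + 1) = qFact q n * (1 - q ^ (n + 1)) :=
  Finset.prod_range_succ _ _

theorem qFact_zero (q : ℂ) : qFact q 0 = 1 := rfl

theorem one_sub_pow_succ_ne_zero {q : ℂ} (hq : ‖q‖ < 1) (n : ℕ) : 1 - q ^ (n + 1) ≠ 0 := by
  intro h
  have h1 : ‖q ^ (n + 1)‖ < 1 := by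
    rw [norm_pow]; exact pow_lt_one₀ (norm_nonneg _) hq (by omega)
  rw [show q ^ (n + 1) = 1 by linear_combination -h] at h1
  simp at h1

theorem qFact_ne_zero {q : ℂ} (hq : ‖q‖ < 1) (n : ℕ) : qFact q n ≠ 0 :=
  Finset.prod_ne_zero_iff.2 fun i _ => one_sub_pow_succ_ne_zero hq i

theorem tendsto_qFact {q : ℂ} (hq : ‖q‖ < 1) : Tendsto (qFact q) atTop (𝓝 (qPoch q q)) :=
  (tendsto_qPoch q hq).congr fun N => Finset.prod_congr rfl fun i _ => by ring

theorem gaussBinom_mul (q : ℂ) : ∀ j k : ℕ,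
    gaussBinom q (j + k) k * (qFact q k * qFact q j) = qFact q (j + k)
  | j, 0 => by simp [gaussBinom_zero_right, qFact_zero]
  | 0, k + 1 => by
    have h := gaussBinom_mul q 0 k
    simp only [zero_add, qFact_zero, mul_one] at h ⊢
    rw [gaussBinom, gaussBinom_eq_zero q (Nat.lt_succ_self k), qFact_succ]
    linear_combination (1 - q ^ (k + 1)) * h
  | j + 1, k + 1 => by
    have h1 := gaussBinom_mul q j (k + 1)
    have h2 := gaussBinom_mul q (j + 1) k
    rw [show j + 1 + k = j + (k + 1) by ring, qFact_succ q j] at h2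
    rw [qFact_succ q k] at h1
    rw [show j + 1 + (k + 1) = (j + (k + 1)) + 1 by ring, gaussBinom, qFact_succ q (j + (k + 1)),
      qFact_succ q j, qFact_succ q k]
    linear_combination (1 - q ^ (j + 1)) * q ^ (k + 1) * h1 + (1 - q ^ (k + 1)) * h2
termination_by j k => j + k

theorem prod_triple_finite {p z : ℂ} (hp : p ≠ 0) (hz : z ≠ 0) (N : ℕ) :
    ∏ i ∈ Finset.range (2 * N), (1 + z * p ^ (1 - 2 * (N : ℤ)) * (p ^ 2) ^ i)
      = z ^ N * p ^ (-((N : ℤ) * N)) *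
        ∏ m ∈ Finset.range N, ((1 + p * z * (p ^ 2) ^ m) * (1 + p / z * (p ^ 2) ^ m)) := by
  rw [two_mul, Finset.prod_range_add, Finset.prod_mul_distrib, mul_comm]
  have h1 : ∏ x ∈ Finset.range N, (1 + z * p ^ (1 - 2 * (N : ℤ)) * (p ^ 2) ^ (N + x))
      = ∏ x ∈ Finset.range N, (1 + p * z * (p ^ 2) ^ x) := by
    refine Finset.prod_congr rfl fun x _ => ?_
    have : p ^ (1 - 2 * (N : ℤ)) * p ^ (2 * (N + x)) = p * p ^ (2 * x) := by
      rw [← zpow_natCast, ← zpow_natCast, ← zpow_add₀ hp, ← zpow_one_add₀ hp]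
      congr 1; push_cast; ring
    rw [← pow_mul, ← pow_mul]
    linear_combination z * this
  have h2 : ∏ x ∈ Finset.range N, (1 + z * p ^ (1 - 2 * (N : ℤ)) * (p ^ 2) ^ x)
      = z ^ N * p ^ (-((N : ℤ) * N)) * ∏ x ∈ Finset.range N, (1 + p / z * (p ^ 2) ^ x) := by
    -- Read backwards, the lower half has factors `1 + z p^(-(2x+1)) = z p^(-(2x+1)) (1 +
    -- p^(2x+1)/z)`; the odd exponents add up to `N^2`.
    rw [← Finset.prod_range_reflect]
    have h3 : ∀ x ∈ Finset.range N, (1 + z * p ^ (1 - 2 * (N : ℤ)) * (p ^ 2) ^ (N - 1 - x))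
        = (z * p ^ (-(2 * (x : ℤ) + 1))) * (1 + p / z * (p ^ 2) ^ x) := by
      intro x hx
      have hx' := Finset.mem_range.1 hx
      have e1 : p ^ (1 - 2 * (N : ℤ)) * p ^ (2 * (N - 1 - x)) = p ^ (-(2 * (x : ℤ) + 1)) := by
        rw [← zpow_natCast, ← zpow_add₀ hp]
        congr 1
        have : ((2 * (N - 1 - x) : ℕ) : ℤ) = 2 * (N - 1 - x) := by omega
        rw [this]; ring
      have e2 : p ^ (-(2 * (x : ℤ) + 1)) * (p * p ^ (2 * x)) = 1 := by
        rw [← zpow_natCast, ← zpow_one_add₀ hp, ← zpow_add₀ hp]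
        rw [← zpow_zero p]; congr 1; push_cast; ring
      rw [← pow_mul, ← pow_mul, mul_assoc, e1]
      field_simp
      linear_combination -e2
    rw [Finset.prod_congr rfl h3, Finset.prod_mul_distrib, Finset.prod_mul_distrib,
      Finset.prod_const, Finset.card_range]
    congr 2
    clear h1 h3
    induction N with
    | zero => simp
    | succ N ih =>
      rw [Finset.prod_range_succ, ih, ← zpow_add₀ hp]; congr 1; push_cast; ring
  rw [h1, h2]; ring

theorem sq_pow_choose_two_mul (p : ℂ) (k : ℕ) : (p ^ 2) ^ (k.choose 2) * p ^ k = p ^ (k * k) := by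
  induction k with
  | zero => simp
  | succ k ih =>
    rw [Nat.choose_succ_succ' k 1, Nat.choose_one_right, show (k + 1) * (k + 1) = k * k + (2 * k + 1)
      by ring, pow_add p (k * k), ← ih]
    ring

/-- The `q`-binomial theorem in base `p^2` with `2N` factors, at `y = z p^(1-2N)`: this start
centres the product, and recentring the index at `N` completes the square in the exponent of `p`. -/
theorem finite_triple_product {p z : ℂ} (hp : p ≠ 0) (hz : z ≠ 0) (N : ℕ) :
    ∏ m ∈ Finset.range N, ((1 + p * z * (p ^ 2) ^ m) * (1 + p / z * (p ^ 2) ^ m))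
      = ∑ k ∈ Finset.range (2 * N + 1), gaussBinom (p ^ 2) (2 * N) k *
          (p ^ (((k : ℤ) - N) * (k - N)) * z ^ ((k : ℤ) - N)) := by
  have h := prod_triple_finite hp hz N
  rw [prod_one_add_mul_pow] at h
  have h0 : z ^ N * p ^ (-((N : ℤ) * N)) ≠ 0 :=
    mul_ne_zero (pow_ne_zero _ hz) (zpow_ne_zero _ hp)
  apply mul_left_cancel₀ h0
  rw [← h, Finset.mul_sum]
  refine Finset.sum_congr rfl fun k _ => ?_
  have e1 : (p ^ 2) ^ (k.choose 2) * (p ^ (1 - 2 * (N : ℤ))) ^ k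
      = p ^ (-((N : ℤ) * N)) * p ^ (((k : ℤ) - N) * (k - N)) := by
    apply mul_right_cancel₀ (pow_ne_zero k hp)
    rw [mul_right_comm, sq_pow_choose_two_mul, ← zpow_natCast (p ^ _), ← zpow_mul,
      ← zpow_natCast, ← zpow_natCast, ← zpow_add₀ hp, ← zpow_add₀ hp, ← zpow_add₀ hp]
    congr 1; push_cast; ring
  have e2 : z ^ k = z ^ N * z ^ ((k : ℤ) - N) := by
    rw [← zpow_natCast, ← zpow_natCast, ← zpow_add₀ hz]; congr 1; ring
  rw [mul_pow, e2]
  linear_combination gaussBinom (p ^ 2) (2 * N) k * (z ^ N * z ^ ((k : ℤ) - N)) * e1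

/-- The terms of the finite triple product, extended by zero to all integers. -/
noncomputable def truncTheta (p z : ℂ) (N : ℕ) (n : ℤ) : ℂ :=
  if n.natAbs ≤ N then gaussBinom (p ^ 2) (2 * N) (n + N).toNat * (p ^ (n * n) * z ^ n) else 0

theorem tsum_truncTheta {p z : ℂ} (hp : p ≠ 0) (hz : z ≠ 0) (N : ℕ) :
    ∑' n : ℤ, truncTheta p z N n
      = ∏ m ∈ Finset.range N, ((1 + p * z * (p ^ 2) ^ m) * (1 + p / z * (p ^ 2) ^ m)) := by
  rw [finite_triple_product hp hz, tsum_eq_sum (s := Finset.Icc (-(N : ℤ)) N)]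
  · refine Finset.sum_nbij' (fun n => (n + N).toNat) (fun k => (k : ℤ) - N) ?_ ?_ ?_ ?_ ?_
    · intro n hn; simp only [Finset.mem_Icc, Finset.mem_range] at *; omega
    · intro n hn; simp only [Finset.mem_Icc, Finset.mem_range] at *; omega
    · intro n hn; simp only [Finset.mem_Icc] at *; omega
    · intro n hn; simp only [Finset.mem_range] at *; omega
    · intro n hn
      simp only [Finset.mem_Icc] at hn
      rw [truncTheta, if_pos (by omega), show (((n + N).toNat : ℕ) : ℤ) - N = n by omega]
  · intro n hn
    simp only [Finset.mem_Icc] at hn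
    rw [truncTheta, if_neg (by omega)]

theorem exists_bound_of_tendsto {f : ℕ → ℂ} {l : ℂ} (h : Tendsto f atTop (𝓝 l)) :
    ∃ C : ℝ, 0 ≤ C ∧ ∀ n, ‖f n‖ ≤ C := by
  obtain ⟨C, hC⟩ := h.norm.bddAbove_range
  exact ⟨C, (norm_nonneg _).trans (hC ⟨0, rfl⟩), fun n => hC ⟨n, rfl⟩⟩

theorem gaussBinom_two_mul {q : ℂ} (hq : ‖q‖ < 1) {N : ℕ} {n : ℤ} (hn : n.natAbs ≤ N) :
    gaussBinom q (2 * N) (n + N).toNat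
      = qFact q (2 * N) * ((qFact q (n + N).toNat)⁻¹ * (qFact q (N - n).toNat)⁻¹) := by
  have h := gaussBinom_mul q (N - n).toNat (n + N).toNat
  rw [show (N - n).toNat + (n + N).toNat = 2 * N by omega] at h
  rw [← h]
  field_simp [qFact_ne_zero hq]

/-- Dominated convergence in the finite version: the central Gaussian binomials tend to `1 / (p^2;
p^2)_∞` and are bounded uniformly, so the theta series itself dominates. -/
theorem jacobi_triple_product {p z : ℂ} (hp0 : p ≠ 0) (hp : ‖p‖ < 1) (hz : z ≠ 0) :
    theta p z = qPoch (p ^ 2) (p ^ 2) * (qPoch (-(p * z)) (p ^ 2) * qPoch (-(p / z)) (p ^ 2)) := by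
  have hq : ‖p ^ 2‖ < 1 := by rw [norm_pow]; exact pow_lt_one₀ (norm_nonneg _) hp two_ne_zero
  have hE := qPoch_ne_zero_of_norm_lt_one hq hq
  have hQ := tendsto_qFact hq
  have hI := hQ.inv₀ hE
  obtain ⟨C, hC0, hC⟩ := exists_bound_of_tendsto hQ
  obtain ⟨K, hK0, hK⟩ := exists_bound_of_tendsto hI
  have hlim : Tendsto (fun N => ∑' n : ℤ, truncTheta p z N n) atTop
      (𝓝 (∑' n : ℤ, (qPoch (p ^ 2) (p ^ 2))⁻¹ * (p ^ (n * n) * z ^ n))) := by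
    refine tendsto_tsum_of_dominated_convergence
      (bound := fun n : ℤ => C * (K * K) * ‖p ^ (n * n) * z ^ n‖)
      ((summable_theta hp z).norm.mul_left _) ?_ ?_
    · intro n
      have h1 : Tendsto (fun N : ℕ => (n + N).toNat) atTop atTop :=
        tendsto_atTop.2 fun b => eventually_atTop.2 ⟨b + n.natAbs, fun N hN => by omega⟩
      have h2 : Tendsto (fun N : ℕ => (N - n).toNat) atTop atTop :=
        tendsto_atTop.2 fun b => eventually_atTop.2 ⟨b + n.natAbs, fun N hN => by omega⟩
      have h3 : Tendsto (fun N : ℕ => 2 * N) atTop atTop :=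
        tendsto_atTop.2 fun b => eventually_atTop.2 ⟨b, fun N hN => by omega⟩
      have h4 := ((hQ.comp h3).mul ((hI.comp h1).mul (hI.comp h2))).mul_const
        (p ^ (n * n) * z ^ n)
      rw [mul_inv_cancel_left₀ hE] at h4
      refine h4.congr' ?_
      filter_upwards [eventually_ge_atTop n.natAbs] with N hN
      rw [truncTheta, if_pos hN, gaussBinom_two_mul hq hN]
      rfl
    · refine Eventually.of_forall fun N n => ?_
      rw [truncTheta]
      split_ifs with hN
      · rw [gaussBinom_two_mul hq hN, norm_mul, norm_mul, norm_mul]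
        gcongr
        · exact hC _
        · exact hK _
        · exact hK _
      · rw [norm_zero]; positivity
  simp only [tsum_truncTheta hp0 hz, Finset.prod_mul_distrib] at hlim
  have h5 := (tendsto_qPoch (-(p * z)) hq).mul (tendsto_qPoch (-(p / z)) hq)
  simp only [neg_mul, sub_neg_eq_add] at h5
  have h6 := tendsto_nhds_unique hlim h5
  rw [tsum_mul_left] at h6
  rw [← h6, mul_inv_cancel_left₀ hE]
  rfl

/-! ### Dissection and multiplication of theta series. -/

theorem theta_inv (p z : ℂ) : theta p z⁻¹ = theta p z := by
  rw [theta, theta, ← (Equiv.neg ℤ).tsum_eq]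
  refine tsum_congr fun n => ?_
  simp

theorem exists_equiv_five_mul_add :
    ∃ e : Fin 5 × ℤ ≃ ℤ, ∀ c, e c = 5 * c.2 + (((c.1 : ℕ) : ℤ) - 2) := by
  -- Shifting by 2 makes the residues `-2, …, 2`, so that at `z = 1` opposite residues pair up under
  -- `theta_inv`.
  refine ⟨((Equiv.prodComm _ _).trans (Int.divModEquiv 5).symm).trans (Equiv.subRight 2), ?_⟩
  rintro ⟨r, m⟩
  have : (Int.divModEquiv 5).symm (m, r) = 5 * m + ((r : ℕ) : ℤ) := by
    rw [Int.divModEquiv_symm_apply, mul_comm]; rfl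
  change (Int.divModEquiv 5).symm (m, r) - 2 = _
  rw [this, add_sub_assoc]

theorem theta_dissection_five {p z : ℂ} (hp0 : p ≠ 0) (hp : ‖p‖ < 1) (hz : z ≠ 0) :
    theta p z = ∑ r : Fin 5, p ^ ((((r : ℕ) : ℤ) - 2) * (((r : ℕ) : ℤ) - 2)) * z ^ (((r : ℕ) : ℤ) - 2)
      * theta (p ^ 25) (p ^ (10 * (((r : ℕ) : ℤ) - 2)) * z ^ 5) := by
  have hp25 : ‖p ^ 25‖ < 1 := by
    rw [norm_pow]; exact pow_lt_one₀ (norm_nonneg _) hp (by norm_num)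
  have hs := summable_theta hp z
  obtain ⟨e, he⟩ := exists_equiv_five_mul_add
  have hterm : ∀ c : Fin 5 × ℤ, p ^ (e c * e c) * z ^ (e c)
      = p ^ ((((c.1 : ℕ) : ℤ) - 2) * (((c.1 : ℕ) : ℤ) - 2)) * z ^ (((c.1 : ℕ) : ℤ) - 2)
        * ((p ^ 25) ^ (c.2 * c.2) * (p ^ (10 * (((c.1 : ℕ) : ℤ) - 2)) * z ^ 5) ^ c.2) := by
    intro c
    rw [he, mul_zpow, ← zpow_natCast p 25, ← zpow_natCast z 5, ← zpow_mul, ← zpow_mul, ← zpow_mul,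
      zpow_add₀ hz, show (5 * c.2 + (((c.1 : ℕ) : ℤ) - 2)) * (5 * c.2 + (((c.1 : ℕ) : ℤ) - 2))
        = ((((c.1 : ℕ) : ℤ) - 2) * (((c.1 : ℕ) : ℤ) - 2)) + (((25 : ℕ) : ℤ) * (c.2 * c.2)
          + 10 * (((c.1 : ℕ) : ℤ) - 2) * c.2) by push_cast; ring, zpow_add₀ hp0, zpow_add₀ hp0]
    push_cast; ring
  have hs2 := (e.summable_iff).2 hs
  simp only [Function.comp_def, hterm] at hs2
  have h3 := hs2.hasSum.prod_fiberwise fun r => ((summable_theta hp25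
    (p ^ (10 * (((r : ℕ) : ℤ) - 2)) * z ^ 5)).hasSum.mul_left
      (p ^ ((((r : ℕ) : ℤ) - 2) * (((r : ℕ) : ℤ) - 2)) * z ^ (((r : ℕ) : ℤ) - 2)))
  have h4 : theta p z = _ := (e.tsum_eq _).symm.trans (tsum_congr hterm)
  rw [← h4] at h3
  exact h3.unique (hasSum_fintype _)

theorem hasSum_congr_fun {ι : Type*} {f g : ι → ℂ} {a : ℂ} (h : ∀ i, f i = g i) :
    HasSum f a ↔ HasSum g a := by
  rw [funext h]

/-- Split the double sum over `(m, n)` by the parity of `m + n`. In coordinates `m = i + j` or `i +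
j + 1`, `n = i - j`, the form `m^2 + n^2` becomes diagonal and each part factors. -/
theorem theta_mul_theta {p z w : ℂ} (hp0 : p ≠ 0) (hp : ‖p‖ < 1) (hz : z ≠ 0) (hw : w ≠ 0) :
    theta p z * theta p w = theta (p ^ 2) (z * w) * theta (p ^ 2) (z / w)
      + p * z * (theta (p ^ 2) (p ^ 2 * (z * w)) * theta (p ^ 2) (p ^ 2 * (z / w))) := by
  have hp2 : ‖p ^ 2‖ < 1 := by rw [norm_pow]; exact pow_lt_one₀ (norm_nonneg _) hp two_ne_zero
  have key : ∀ {r x y : ℂ}, ‖r‖ < 1 → HasSum (fun c : ℤ × ℤ => (r ^ (c.1 * c.1) * x ^ c.1)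
      * (r ^ (c.2 * c.2) * y ^ c.2)) (theta r x * theta r y) := by
    intro r x y hr
    have h1 := summable_theta hr x
    have h2 := summable_theta hr y
    have h3 := summable_mul_of_summable_norm h1.norm h2.norm
    have h4 := h3.hasSum
    rwa [← h1.tsum_mul_tsum h2 h3] at h4
  let g₀ : ℤ × ℤ → ℤ × ℤ := fun c => (c.1 + c.2, c.1 - c.2)
  let g₁ : ℤ × ℤ → ℤ × ℤ := fun c => (c.1 + c.2 + 1, c.1 - c.2)
  have i₀ : Function.Injective g₀ := by
    rintro ⟨a, b⟩ ⟨c, d⟩ h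
    simp only [g₀, Prod.mk.injEq] at h
    ext <;> simp only <;> omega
  have i₁ : Function.Injective g₁ := by
    rintro ⟨a, b⟩ ⟨c, d⟩ h
    simp only [g₁, Prod.mk.injEq] at h
    ext <;> simp only <;> omega
  have hc : IsCompl (Set.range g₀) (Set.range g₁) := by
    constructor
    · rw [Set.disjoint_left]
      rintro _ ⟨⟨a, b⟩, rfl⟩ ⟨⟨c, d⟩, h⟩
      simp only [g₀, g₁, Prod.mk.injEq] at h
      omega
    · rw [codisjoint_iff_le_sup]
      rintro ⟨m, n⟩ -
      rcases Int.even_or_odd (m + n) with ⟨k, hk⟩ | ⟨k, hk⟩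
      · left; refine ⟨(k, m - k), ?_⟩
        simp only [g₀, Prod.mk.injEq]; omega
      · right; refine ⟨(k, m - k - 1), ?_⟩
        simp only [g₁, Prod.mk.injEq]; omega
  refine (key hp).unique (HasSum.add_isCompl (s := Set.range g₀) (t := Set.range g₁) hc
    ((i₀.hasSum_range_iff (f := fun c : ℤ × ℤ => (p ^ (c.1 * c.1) * z ^ c.1)
      * (p ^ (c.2 * c.2) * w ^ c.2))).2 ?_) ((i₁.hasSum_range_iff (f := fun c : ℤ × ℤ =>
      (p ^ (c.1 * c.1) * z ^ c.1) * (p ^ (c.2 * c.2) * w ^ c.2))).2 ?_))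
  · refine (hasSum_congr_fun ?_).2 (key hp2 (x := z * w) (y := z / w))
    rintro ⟨i, j⟩
    simp only [Function.comp_apply, g₀]
    rw [← zpow_natCast p 2, ← zpow_mul, ← zpow_mul, mul_zpow, div_zpow, zpow_add₀ hz, zpow_sub₀ hw,
      mul_mul_mul_comm, ← zpow_add₀ hp0, mul_mul_mul_comm, ← zpow_add₀ hp0]
    rw [show (i + j) * (i + j) + (i - j) * (i - j) = ((2 : ℕ) : ℤ) * (i * i) + ((2 : ℕ) : ℤ) * (j * j)
      by push_cast; ring]
    ring
  · refine (hasSum_congr_fun ?_).2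
      ((key hp2 (x := p ^ 2 * (z * w)) (y := p ^ 2 * (z / w))).mul_left (p * z))
    rintro ⟨i, j⟩
    simp only [Function.comp_apply, g₁]
    rw [← zpow_natCast p 2, ← zpow_mul, ← zpow_mul, mul_zpow, mul_zpow, mul_zpow, div_zpow,
      zpow_add₀ hz, zpow_add₀ hz, zpow_sub₀ hw, mul_mul_mul_comm, ← zpow_add₀ hp0, zpow_one,
      ← zpow_mul, ← zpow_mul]
    rw [show (i + j + 1) * (i + j + 1) + (i - j) * (i - j)
      = ((2 : ℕ) : ℤ) * (i * i) + (((2 : ℕ) : ℤ) * (j * j) + (((2 : ℕ) : ℤ) * i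
        + (((2 : ℕ) : ℤ) * j + 1)))
      by push_cast; ring, zpow_add₀ hp0, zpow_add₀ hp0, zpow_add₀ hp0, zpow_add₀ hp0, zpow_one]
    ring

/-- Ramanujan's general theta function `f(a, b)`, in product form. -/
noncomputable def ramF (a b : ℂ) : ℂ :=
  qPoch (a * b) (a * b) * (qPoch (-a) (a * b) * qPoch (-b) (a * b))

theorem theta_eq_ramF {p z a b : ℂ} (hp0 : p ≠ 0) (hp : ‖p‖ < 1) (ha : a = p * z)
    (hb : b = p / z) (hz : z ≠ 0) : theta p z = ramF a b := by
  have : a * b = p ^ 2 := by rw [ha, hb]; field_simp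
  rw [ramF, this, ha, hb, jacobi_triple_product hp0 hp hz]

/-- This is `theta_mul_theta` with nome `p` a square root of `a * b = c * d`, at `z = a / p` and `w
= c / p`. It is the source of all the additive product identities below. -/
theorem ramF_mul_ramF {a b c d : ℂ} (ha : a ≠ 0) (hb : b ≠ 0) (hc : c ≠ 0) (hd : d ≠ 0)
    (h : a * b = c * d) (h1 : ‖a * b‖ < 1) :
    ramF a b * ramF c d = ramF (a * c) (b * d) * ramF (a * d) (b * c)
      + a * (ramF (a * c ^ 2 * d) (b / c) * ramF (a * c * d ^ 2) (b / d)) := by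
  obtain ⟨p, hp⟩ := IsAlgClosed.exists_pow_nat_eq (a * b) two_pos
  have hp0 : p ≠ 0 := by rintro rfl; simp [ha, hb] at hp
  have hp1 : ‖p‖ < 1 := by
    rw [← hp, norm_pow] at h1
    exact (pow_lt_one_iff_of_nonneg (norm_nonneg _) two_ne_zero).1 h1
  have hp2 : ‖p ^ 2‖ < 1 := by rwa [hp]
  have hp20 : p ^ 2 ≠ 0 := pow_ne_zero _ hp0
  have hb' : b = p ^ 2 / a := by rw [hp]; field_simp
  have hd' : d = p ^ 2 / c := by rw [hp, h]; field_simp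
  have := theta_mul_theta hp0 hp1 (div_ne_zero ha hp0) (div_ne_zero hc hp0)
  rw [theta_eq_ramF (a := a) (b := b) hp0 hp1 (by field_simp) (by rw [hb']; field_simp)
      (div_ne_zero ha hp0),
    theta_eq_ramF (a := c) (b := d) hp0 hp1 (by field_simp) (by rw [hd']; field_simp)
      (div_ne_zero hc hp0),
    theta_eq_ramF (p := p ^ 2) (a := a * c) (b := b * d) hp20 hp2 (by field_simp)
      (by rw [hb', hd']; field_simp)
      (by simp [ha, hc, hp0]),
    theta_eq_ramF (p := p ^ 2) (a := a * d) (b := b * c) hp20 hp2 (by rw [hd']; field_simp)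
      (by rw [hb']; field_simp)
      (by simp [ha, hc, hp0]),
    theta_eq_ramF (p := p ^ 2) (a := a * c ^ 2 * d) (b := b / c) hp20 hp2
      (by rw [hd']; field_simp) (by rw [hb']; field_simp)
      (by simp [ha, hc, hp0]),
    theta_eq_ramF (p := p ^ 2) (a := a * c * d ^ 2) (b := b / d) hp20 hp2
      (by rw [hd']; field_simp) (by rw [hb', hd']; field_simp)
      (by simp [ha, hc, hp0])] at this
  rw [this]
  field_simp

/-! ### The Rogers–Selberg series and its recurrence. -/

/-- The terms of the Rogers-Selberg series that sums to `(q; q)_∞ ∑ q^(k^2 + mk) / (q; q)_k`. -/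
noncomputable def rrTerm (q : ℂ) (m n : ℕ) : ℂ :=
  (-1) ^ n * q ^ (2 * m * n + 2 * n * n + (n + 1).choose 2) * (1 - q ^ (2 * m + 4 * n + 2))
    * (qFact q (m + n) * (qFact q n)⁻¹)

/-- The terms of the companion series of `rrTerm`. -/
noncomputable def rrTerm' (q : ℂ) (m n : ℕ) : ℂ :=
  (-1) ^ n * q ^ (2 * m * n + 2 * n * n + n + (n + 1).choose 2) * (1 - q ^ (m + 2 * n + 1))
    * (qFact q (m + n) * (qFact q n)⁻¹)

theorem exists_bound_qFact_div {q : ℂ} (hq : ‖q‖ < 1) :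
    ∃ C : ℝ, 0 ≤ C ∧ ∀ m n, ‖qFact q m * (qFact q n)⁻¹‖ ≤ C := by
  have hQ := tendsto_qFact hq
  obtain ⟨C, hC0, hC⟩ := exists_bound_of_tendsto hQ
  obtain ⟨K, hK0, hK⟩ := exists_bound_of_tendsto
    (hQ.inv₀ (qPoch_ne_zero_of_norm_lt_one hq hq))
  refine ⟨C * K, mul_nonneg hC0 hK0, fun m n => ?_⟩
  rw [norm_mul]
  exact mul_le_mul (hC m) (hK n) (norm_nonneg _) hC0

theorem norm_one_sub_pow_le {q : ℂ} (hq : ‖q‖ < 1) (n : ℕ) : ‖1 - q ^ n‖ ≤ 2 := by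
  refine (norm_sub_le _ _).trans ?_
  rw [norm_one, norm_pow]
  linarith [pow_le_one₀ (n := n) (norm_nonneg q) hq.le]

theorem norm_rr_le {q : ℂ} (hq : ‖q‖ < 1) {C : ℝ}
    (hC : ∀ m n, ‖qFact q m * (qFact q n)⁻¹‖ ≤ C) {e n : ℕ} (he : n ≤ e) (k a b : ℕ) :
    ‖(-1) ^ n * q ^ e * (1 - q ^ k) * (qFact q a * (qFact q b)⁻¹)‖ ≤ 2 * C * ‖q‖ ^ n := by
  have h1 : ‖(-1) ^ n * q ^ e‖ ≤ ‖q‖ ^ n := by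
    simpa using pow_le_pow_of_le_one (norm_nonneg q) hq.le he
  have h2 := norm_one_sub_pow_le hq k
  have h3 := hC a b
  rw [norm_mul, norm_mul]
  calc _ ≤ ‖q‖ ^ n * 2 * C := by gcongr
    _ = _ := by ring

theorem norm_rrTerm_le {q : ℂ} (hq : ‖q‖ < 1) {C : ℝ}
    (hC : ∀ m n, ‖qFact q m * (qFact q n)⁻¹‖ ≤ C) (m n : ℕ) :
    ‖rrTerm q m n‖ ≤ 2 * C * ‖q‖ ^ n :=
  norm_rr_le hq hC (by rw [Nat.choose_succ_succ' n 1, Nat.choose_one_right]; omega) _ _ _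

theorem norm_rrTerm'_le {q : ℂ} (hq : ‖q‖ < 1) {C : ℝ}
    (hC : ∀ m n, ‖qFact q m * (qFact q n)⁻¹‖ ≤ C) (m n : ℕ) :
    ‖rrTerm' q m n‖ ≤ 2 * C * ‖q‖ ^ n :=
  norm_rr_le hq hC (by omega) _ _ _

theorem summable_of_norm_le_geometric {q : ℂ} (hq : ‖q‖ < 1) {f : ℕ → ℂ} {C : ℝ}
    (h : ∀ n, ‖f n‖ ≤ C * ‖q‖ ^ n) : Summable f :=
  Summable.of_norm_bounded ((summable_geometric_of_lt_one (norm_nonneg _) hq).mul_left C) h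

theorem tendsto_zero_of_norm_le_geometric {q : ℂ} (hq : ‖q‖ < 1) {f : ℕ → ℂ} {C : ℝ}
    (h : ∀ n, ‖f n‖ ≤ C * ‖q‖ ^ n) : Tendsto f atTop (𝓝 0) :=
  (summable_of_norm_le_geometric hq h).tendsto_atTop_zero

theorem summable_rrTerm {q : ℂ} (hq : ‖q‖ < 1) (m : ℕ) : Summable (rrTerm q m) := by
  obtain ⟨C, -, hC⟩ := exists_bound_qFact_div hq
  exact summable_of_norm_le_geometric hq (norm_rrTerm_le hq hC m)

theorem summable_rrTerm' {q : ℂ} (hq : ‖q‖ < 1) (m : ℕ) : Summable (rrTerm' q m) := by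
  obtain ⟨C, -, hC⟩ := exists_bound_qFact_div hq
  exact summable_of_norm_le_geometric hq (norm_rrTerm'_le hq hC m)

theorem tsum_eq_zero_of_telescope {f G : ℕ → ℂ} (hf : Summable f)
    (h : ∀ n, f n = G n - G (n + 1)) (h0 : G 0 = 0) (hG : Tendsto G atTop (𝓝 0)) :
    ∑' n, f n = 0 := by
  refine tendsto_nhds_unique hf.hasSum.tendsto_sum_nat ?_
  have : (fun n => ∑ i ∈ Finset.range n, f i) = fun n => -G n := by
    ext n
    simp only [h, Finset.sum_range_sub', h0, zero_sub]
  rw [this]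
  simpa using hG.neg

theorem tsum_rrTerm' {q : ℂ} (hq : ‖q‖ < 1) (m : ℕ) :
    ∑' n, rrTerm' q m n = ∑' n, rrTerm q (m + 1) n := by
  obtain ⟨C, -, hC⟩ := exists_bound_qFact_div hq
  have hs := (summable_rrTerm' hq m).sub (summable_rrTerm hq (m + 1))
  rw [← sub_eq_zero, ← (summable_rrTerm' hq m).tsum_sub (summable_rrTerm hq (m + 1))]
  -- The certificate comes from splitting `1 - q^(m+2n+1)` as `(1 - q^n) + q^n (1 - q^(m+n+1))`; the
  -- factor `1 - q ^ n` makes it vanish at `n = 0`.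
  refine tsum_eq_zero_of_telescope (G := fun n => (-1) ^ n *
      q ^ (2 * m * n + 2 * n * n + n + (n + 1).choose 2) * (1 - q ^ n)
      * (qFact q (m + n) * (qFact q n)⁻¹)) hs ?_ (by simp)
    (tendsto_zero_of_norm_le_geometric hq fun n => norm_rr_le hq hC (by omega) _ _ _)
  intro n
  have h1 := qFact_ne_zero hq n
  have h2 := one_sub_pow_succ_ne_zero hq n
  simp only [rrTerm, rrTerm']
  rw [Nat.choose_succ_succ' (n + 1) 1, Nat.choose_one_right, show m + 1 + n = m + n + 1 by ring,
    ← add_assoc m n 1, qFact_succ, qFact_succ]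
  field_simp
  ring

theorem tsum_rrTerm_sub {q : ℂ} (hq : ‖q‖ < 1) (m : ℕ) :
    ∑' n, rrTerm q m n = ∑' n, rrTerm' q m n + q ^ (m + 1) * ∑' n, rrTerm' q (m + 1) n := by
  obtain ⟨C, -, hC⟩ := exists_bound_qFact_div hq
  have hs1 := (summable_rrTerm' hq (m + 1)).mul_left (q ^ (m + 1))
  have hs2 := (summable_rrTerm' hq m).add hs1
  rw [← sub_eq_zero, ← tsum_mul_left, ← (summable_rrTerm' hq m).tsum_add hs1,
    ← (summable_rrTerm hq m).tsum_sub hs2]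
  -- The same certificate without the extra `q ^ n`.
  refine tsum_eq_zero_of_telescope (G := fun n => (-1) ^ n *
      q ^ (2 * m * n + 2 * n * n + (n + 1).choose 2) * (1 - q ^ n)
      * (qFact q (m + n) * (qFact q n)⁻¹)) ((summable_rrTerm hq m).sub hs2) ?_ (by simp)
    (tendsto_zero_of_norm_le_geometric hq fun n => norm_rr_le hq hC
      (by rw [Nat.choose_succ_succ' n 1, Nat.choose_one_right]; omega) _ _ _)
  intro n
  have h1 := qFact_ne_zero hq n
  have h2 := one_sub_pow_succ_ne_zero hq n
  simp only [rrTerm, rrTerm']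
  rw [Nat.choose_succ_succ' (n + 1) 1, Nat.choose_one_right, show m + 1 + n = m + n + 1 by ring,
    ← add_assoc m n 1, qFact_succ, qFact_succ]
  field_simp
  ring

/-- The Rogers-Ramanujan function `∑ q^(k^2 + mk) / (q; q)_k`, by its Rogers-Selberg series. -/
noncomputable def rrSum (q : ℂ) (m : ℕ) : ℂ := (∑' n, rrTerm q m n) / qPoch q q

theorem rrSum_recurrence {q : ℂ} (hq : ‖q‖ < 1) (m : ℕ) :
    rrSum q m = rrSum q (m + 1) + q ^ (m + 1) * rrSum q (m + 2) := by
  rw [rrSum, tsum_rrTerm_sub hq, tsum_rrTerm' hq, tsum_rrTerm' hq, rrSum, rrSum]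
  ring

theorem tendsto_rrSum {q : ℂ} (hq : ‖q‖ < 1) : Tendsto (rrSum q) atTop (𝓝 1) := by
  obtain ⟨C, -, hC⟩ := exists_bound_qFact_div hq
  have hE := qPoch_ne_zero_of_norm_lt_one hq hq
  have key : Tendsto (fun m => ∑' n, rrTerm q m n) atTop
      (𝓝 (∑' n : ℕ, if n = 0 then qPoch q q else 0)) := by
    refine tendsto_tsum_of_dominated_convergence (bound := fun n => 2 * C * ‖q‖ ^ n)
      ((summable_geometric_of_lt_one (norm_nonneg _) hq).mul_left _) ?_
      (Eventually.of_forall fun m n => norm_rrTerm_le hq hC m n)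
    intro n
    split_ifs with hn
    · subst hn
      have h1 : Tendsto (fun m : ℕ => q ^ (2 * m + 2)) atTop (𝓝 0) :=
        (tendsto_pow_atTop_nhds_zero_of_norm_lt_one hq).comp
          (tendsto_atTop.2 fun b => eventually_atTop.2 ⟨b, fun m hm => by omega⟩)
      have h2 := (h1.const_sub 1).mul (tendsto_qFact hq)
      rw [sub_zero, one_mul] at h2
      refine h2.congr fun m => ?_
      simp [rrTerm, qFact_zero]
    · refine tendsto_zero_of_norm_le_geometric hq (C := 2 * C) fun m => ?_
      -- Since `n ≥ 1`, the exponent is at least `m`, so the term decays in `m`. The sign is changed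
      -- to `(-1) ^ m`, harmless under the norm, to fit `norm_rr_le`.
      have h3 : ‖rrTerm q m n‖ = ‖(-1) ^ m * q ^ (2 * m * n + 2 * n * n + (n + 1).choose 2)
          * (1 - q ^ (2 * m + 4 * n + 2)) * (qFact q (m + n) * (qFact q n)⁻¹)‖ := by
        simp [rrTerm]
      rw [h3]
      refine norm_rr_le hq hC ?_ _ _ _
      have : m * 1 ≤ m * n := Nat.mul_le_mul_left m (Nat.one_le_iff_ne_zero.2 hn)
      nlinarith [Nat.zero_le ((n + 1).choose 2)]
  rw [tsum_ite_eq] at key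
  have := key.div_const (qPoch q q)
  rwa [div_self hE] at this

/-! ### The Rogers–Selberg series at `m = 0` as theta functions. -/

theorem five_mul_choose (n : ℕ) :
    5 * (n + 1).choose 2 = 2 * n * n + 2 * n + (n + 1).choose 2 := by
  have h : ∀ n : ℕ, 2 * (n + 1).choose 2 = n * n + n := by
    intro n
    induction n with
    | zero => rfl
    | succ k ih => rw [Nat.choose_succ_succ' (k + 1) 1, Nat.choose_one_right]; nlinarith
  nlinarith [h n]

/-- Folds a two-sided series by pairing `n` with `-(n + 1)`; the two halves of the factor `1 -
q^(…)` in `rrTerm q 0` and `rrTerm' q 0` are such a pair. -/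
theorem tsum_eq_theta {p z : ℂ} (hp : ‖p‖ < 1) {f : ℕ → ℂ}
    (h : ∀ n : ℕ, f n = p ^ ((n : ℤ) * n) * z ^ (n : ℤ)
      + p ^ ((-((n : ℤ) + 1)) * (-((n : ℤ) + 1))) * z ^ (-((n : ℤ) + 1))) :
    ∑' n, f n = theta p z := by
  have hs := summable_theta hp z
  have h1 : Summable fun n : ℕ => p ^ ((n : ℤ) * n) * z ^ (n : ℤ) :=
    hs.comp_injective Nat.cast_injective
  have h2 : Summable fun n : ℕ => p ^ ((-((n : ℤ) + 1)) * (-((n : ℤ) + 1)))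
      * z ^ (-((n : ℤ) + 1)) :=
    hs.comp_injective (i := fun n : ℕ => -((n : ℤ) + 1)) fun a b hab => by
      simp only at hab; omega
  have h3 := HasSum.of_nat_of_neg_add_one (f := fun n : ℤ => p ^ (n * n) * z ^ n)
    h1.hasSum h2.hasSum
  rw [tsum_congr h, h1.tsum_add h2]
  exact h3.unique hs.hasSum

theorem pow_choose_two_succ {p : ℂ} (n : ℕ) : (p ^ 2) ^ ((n + 1).choose 2) = p ^ (n * n) * p ^ n := by
  rw [← sq_pow_choose_two_mul, Nat.choose_succ_succ' n 1, Nat.choose_one_right]; ring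

theorem tsum_rrTerm_zero {q : ℂ} (hq0 : q ≠ 0) (hq : ‖q‖ < 1) :
    ∑' n, rrTerm q 0 n = ramF (-q ^ 3) (-q ^ 2) := by
  obtain ⟨p, hp⟩ := IsAlgClosed.exists_pow_nat_eq (q ^ 5) two_pos
  have hp0 : p ≠ 0 := by
    rintro rfl; exact pow_ne_zero 5 hq0 (by simpa using hp.symm)
  have hp1 : ‖p‖ < 1 := by
    have : ‖p ^ 2‖ < 1 := by
      rw [hp, norm_pow]; exact pow_lt_one₀ (norm_nonneg _) hq (by norm_num)
    rw [norm_pow] at this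
    exact (pow_lt_one_iff_of_nonneg (norm_nonneg _) two_ne_zero).1 this
  rw [← theta_eq_ramF (p := p) (z := -p / q ^ 2) hp0 hp1
    (by field_simp; linear_combination hp) (by field_simp) (by simp [hp0, hq0])]
  refine tsum_eq_theta hp1 fun n => ?_
  have e := pow_choose_two_succ (p := p) n
  rw [hp, ← pow_mul, five_mul_choose] at e
  have e1 : (-p / q ^ 2) ^ (-((n : ℤ) + 1)) = (-1) ^ (n + 1) * (q ^ 2) ^ (n + 1) / p ^ (n + 1) := by
    rw [zpow_neg, ← inv_zpow, inv_div, ← Nat.cast_add_one, zpow_natCast, div_pow, neg_pow p]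
    have : ((-1 : ℂ) ^ (n + 1)) * (-1) ^ (n + 1) = 1 := by rw [← mul_pow]; simp
    field_simp
    linear_combination -this
  rw [e1, neg_mul_neg, ← Nat.cast_add_one, ← Nat.cast_mul, ← Nat.cast_mul, zpow_natCast, zpow_natCast,
    zpow_natCast, div_pow, neg_pow p, rrTerm, zero_add n, mul_inv_cancel₀ (qFact_ne_zero hq n)]
  have e2 : q ^ (2 * 0 * n + 2 * n * n + (n + 1).choose 2) * q ^ (2 * n) = p ^ (n * n) * p ^ n := by
    rw [← e]; ring
  have e3 : p ^ ((n + 1) * (n + 1)) = (p ^ (n * n) * p ^ n) * p ^ (n + 1) := by ring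
  rw [e3, mul_div_assoc', mul_comm ((-1) ^ n) (p ^ n), ← mul_div_assoc,
    ← mul_assoc, ← e2]
  field_simp
  ring

theorem tsum_rrTerm'_zero {q : ℂ} (hq0 : q ≠ 0) (hq : ‖q‖ < 1) :
    ∑' n, rrTerm' q 0 n = ramF (-q ^ 4) (-q) := by
  obtain ⟨p, hp⟩ := IsAlgClosed.exists_pow_nat_eq (q ^ 5) two_pos
  have hp0 : p ≠ 0 := by
    rintro rfl; exact pow_ne_zero 5 hq0 (by simpa using hp.symm)
  have hp1 : ‖p‖ < 1 := by
    have : ‖p ^ 2‖ < 1 := by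
      rw [hp, norm_pow]; exact pow_lt_one₀ (norm_nonneg _) hq (by norm_num)
    rw [norm_pow] at this
    exact (pow_lt_one_iff_of_nonneg (norm_nonneg _) two_ne_zero).1 this
  rw [← theta_eq_ramF (p := p) (z := -p / q) hp0 hp1
    (by field_simp; linear_combination hp) (by field_simp) (by simp [hp0, hq0])]
  refine tsum_eq_theta hp1 fun n => ?_
  have e := pow_choose_two_succ (p := p) n
  rw [hp, ← pow_mul, five_mul_choose] at e
  have e1 : (-p / q) ^ (-((n : ℤ) + 1)) = (-1) ^ (n + 1) * q ^ (n + 1) / p ^ (n + 1) := by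
    rw [zpow_neg, ← inv_zpow, inv_div, ← Nat.cast_add_one, zpow_natCast, div_pow, neg_pow p]
    have : ((-1 : ℂ) ^ (n + 1)) * (-1) ^ (n + 1) = 1 := by rw [← mul_pow]; simp
    field_simp
    linear_combination -this
  rw [e1, neg_mul_neg, ← Nat.cast_add_one, ← Nat.cast_mul, ← Nat.cast_mul, zpow_natCast, zpow_natCast,
    zpow_natCast, div_pow, neg_pow p, rrTerm', zero_add n, mul_inv_cancel₀ (qFact_ne_zero hq n)]
  have e2 : q ^ (2 * 0 * n + 2 * n * n + n + (n + 1).choose 2) * q ^ n = p ^ (n * n) * p ^ n := by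
    rw [← e]; ring
  have e3 : p ^ ((n + 1) * (n + 1)) = (p ^ (n * n) * p ^ n) * p ^ (n + 1) := by ring
  rw [e3, mul_div_assoc', mul_comm ((-1) ^ n) (p ^ n), ← mul_div_assoc,
    ← mul_assoc, ← e2]
  field_simp
  ring

/-! ### Convergence of the continued fraction. -/

/-- The products `M ∏ (1 + |q|^i)` form an increasing majorant, bounded by `M exp (∑ |q|^i)`. -/
theorem exists_bound_of_recurrence {q : ℂ} (hq : ‖q‖ < 1) {X : ℕ → ℂ}
    (h : ∀ n, X (n + 2) = X (n + 1) + q ^ (n + 1) * X n) : ∃ C : ℝ, 0 ≤ C ∧ ∀ n, ‖X n‖ ≤ C := by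
  set M := ‖X 0‖ + ‖X 1‖ with hM
  have hM0 : 0 ≤ M := by positivity
  let b : ℕ → ℝ := fun n => M * ∏ i ∈ Finset.range n, (1 + ‖q‖ ^ i)
  have hb0 : ∀ n, 0 ≤ b n := fun n =>
    mul_nonneg hM0 (Finset.prod_nonneg fun i _ => by positivity)
  have hbs : ∀ n, b (n + 1) = b n * (1 + ‖q‖ ^ n) := fun n => by
    simp only [b, Finset.prod_range_succ]; ring
  have hmono : ∀ n, b n ≤ b (n + 1) := fun n => by
    rw [hbs]; exact le_mul_of_one_le_right (hb0 n) (by simp)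
  have key : ∀ n, ‖X n‖ ≤ b n ∧ ‖X (n + 1)‖ ≤ b (n + 1) := by
    intro n
    induction n with
    | zero =>
      have h0 : ‖X 0‖ ≤ b 0 := by simp [b, hM]
      have h1 : ‖X 1‖ ≤ b 0 := by simp [b, hM]
      exact ⟨h0, h1.trans (hmono 0)⟩
    | succ n ih =>
      refine ⟨ih.2, ?_⟩
      rw [h, hbs (n + 1)]
      refine (norm_add_le _ _).trans ?_
      rw [norm_mul, norm_pow, mul_add, mul_one]
      have : ‖q‖ ^ (n + 1) * ‖X n‖ ≤ ‖q‖ ^ (n + 1) * b (n + 1) :=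
        mul_le_mul_of_nonneg_left (ih.1.trans (hmono n)) (by positivity)
      linarith [ih.2]
  have hsum := summable_geometric_of_lt_one (norm_nonneg q) hq
  refine ⟨M * Real.exp (∑' i, ‖q‖ ^ i), by positivity, fun n => (key n).1.trans ?_⟩
  refine mul_le_mul_of_nonneg_left ?_ hM0
  calc ∏ i ∈ Finset.range n, (1 + ‖q‖ ^ i)
      ≤ ∏ i ∈ Finset.range n, Real.exp (‖q‖ ^ i) :=
        Finset.prod_le_prod (fun i _ => by positivity) fun i _ => by
          linarith [Real.add_one_le_exp (‖q‖ ^ i)]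
    _ = Real.exp (∑ i ∈ Finset.range n, ‖q‖ ^ i) := (Real.exp_sum _ _).symm
    _ ≤ _ := Real.exp_le_exp.2 (hsum.sum_le_tsum _ fun i _ => by positivity)

/-- The recurrence of `rrSum` is adjoint to that of `X`, so `X_(n+1) F_(n+1) + q^(n+1) X_n F_(n+2)`
does not depend on `n`. Its second term tends to 0 because `X` is bounded, and `F_n → 1`. -/
theorem tendsto_of_recurrence {q : ℂ} (hq : ‖q‖ < 1) {X : ℕ → ℂ}
    (h : ∀ n, X (n + 2) = X (n + 1) + q ^ (n + 1) * X n) :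
    Tendsto X atTop (𝓝 (X 1 * rrSum q 1 + q * X 0 * rrSum q 2)) := by
  obtain ⟨C, hC0, hC⟩ := exists_bound_of_recurrence hq h
  have inv : ∀ n, X 1 * rrSum q 1 + q * X 0 * rrSum q 2
      = X (n + 1) * rrSum q (n + 1) + q ^ (n + 1) * X n * rrSum q (n + 2) := by
    intro n
    induction n with
    | zero => simp
    | succ n ih => rw [ih, h, rrSum_recurrence hq (n + 1)]; ring
  have hF := tendsto_rrSum hq
  have h0 : Tendsto (fun n => q ^ (n + 1) * X n) atTop (𝓝 0) := by
    refine tendsto_zero_of_norm_le_geometric hq (C := C) fun n => ?_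
    rw [norm_mul, norm_pow, mul_comm]
    exact mul_le_mul (hC n) (pow_le_pow_of_le_one (norm_nonneg _) hq.le (Nat.le_succ n))
      (by positivity) hC0
  have h1 : Tendsto (fun n => X (n + 1) * rrSum q (n + 1)) atTop
      (𝓝 (X 1 * rrSum q 1 + q * X 0 * rrSum q 2)) := by
    have := (h0.mul (hF.comp (tendsto_add_atTop_nat 2))).const_sub
      (X 1 * rrSum q 1 + q * X 0 * rrSum q 2)
    rw [zero_mul, sub_zero] at this
    refine this.congr fun n => ?_
    simp only [Function.comp_apply]
    rw [inv n]; ring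
  have hF1 := hF.comp (tendsto_add_atTop_nat 1)
  have h2 := h1.div hF1 one_ne_zero
  rw [div_one] at h2
  refine (tendsto_add_atTop_iff_nat 1).1 (h2.congr' ?_)
  filter_upwards [hF1.eventually_ne one_ne_zero] with n hn
  simp only [Function.comp_apply] at hn
  simp only [Pi.div_apply, Function.comp_apply]
  field_simp

theorem rogersRamanujanFract_get (r q : ℂ) (n : ℕ) :
    (rogersRamanujanFract r q).s.get? n = some ⟨if n = 0 then r else q ^ n, 1⟩ := rfl

theorem tendsto_rogersRamanujanFract_of_ne_zero (r : ℂ) {q : ℂ} (hq : ‖q‖ < 1)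
    (h0 : rrSum q 0 ≠ 0) :
    Tendsto (fun n : ℕ => (rogersRamanujanFract r q).convs n) atTop
      (𝓝 (r * rrSum q 1 / rrSum q 0)) := by
  have hg0 := rogersRamanujanFract_get r q 0
  have hg : ∀ n, (rogersRamanujanFract r q).s.get? (n + 1) = some ⟨q ^ (n + 1), 1⟩ := fun n => by
    rw [rogersRamanujanFract_get, if_neg (Nat.succ_ne_zero n)]
  have hA := tendsto_of_recurrence hq (X := (rogersRamanujanFract r q).nums) fun n => by
    rw [GenContFract.nums_recurrence (hg n) rfl rfl]; ring
  have hB := tendsto_of_recurrence hq (X := (rogersRamanujanFract r q).dens) fun n => by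
    rw [GenContFract.dens_recurrence (hg n) rfl rfl]; ring
  rw [GenContFract.first_num_eq hg0, GenContFract.zeroth_num_eq_h] at hA
  rw [GenContFract.first_den_eq hg0, GenContFract.zeroth_den_eq_one] at hB
  simp only [rogersRamanujanFract, if_true, mul_zero, zero_mul, add_zero, zero_add, one_mul,
    mul_one] at hA hB
  have e : rrSum q 1 + q * rrSum q 2 = rrSum q 0 := by
    rw [rrSum_recurrence hq 0]; simp
  rw [e] at hB
  exact hA.div hB h0

theorem ramF_ne_zero {a b : ℂ} (ha : ‖a‖ < 1) (hb : ‖b‖ < 1) : ramF a b ≠ 0 := by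
  have hab : ‖a * b‖ < 1 := by
    rw [norm_mul]; exact mul_lt_one_of_nonneg_of_lt_one_left (norm_nonneg _) ha hb.le
  exact mul_ne_zero (qPoch_ne_zero_of_norm_lt_one hab hab)
    (mul_ne_zero (qPoch_ne_zero_of_norm_lt_one hab (by rwa [norm_neg]))
      (qPoch_ne_zero_of_norm_lt_one hab (by rwa [norm_neg])))

/-- The Rogers-Ramanujan continued fraction converges to a quotient of theta functions. -/
theorem tendsto_rogersRamanujanFract (r : ℂ) {q : ℂ} (hq0 : q ≠ 0) (hq : ‖q‖ < 1) :
    Tendsto (fun n : ℕ => (rogersRamanujanFract r q).convs n) atTop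
      (𝓝 (r * ramF (-q ^ 4) (-q) / ramF (-q ^ 3) (-q ^ 2))) := by
  have hE := qPoch_ne_zero_of_norm_lt_one hq hq
  have hn : ∀ k ≠ 0, ‖-q ^ k‖ < 1 := fun k hk => by
    rw [norm_neg, norm_pow]; exact pow_lt_one₀ (norm_nonneg _) hq hk
  have h0 : rrSum q 0 = ramF (-q ^ 3) (-q ^ 2) / qPoch q q := by
    rw [rrSum, tsum_rrTerm_zero hq0 hq]
  have h1 : rrSum q 1 = ramF (-q ^ 4) (-q) / qPoch q q := by
    rw [rrSum, ← tsum_rrTerm'_zero hq0 hq, tsum_rrTerm' hq 0]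
  have hR := ramF_ne_zero (hn 3 (by norm_num)) (hn 2 (by norm_num))
  have := tendsto_rogersRamanujanFract_of_ne_zero r hq (by rw [h0]; exact div_ne_zero hR hE)
  rw [h0, h1, mul_div_assoc', div_div_div_cancel_right₀ hE] at this
  exact this

theorem rogersRamanujan_eq (r : ℂ) {q : ℂ} (hq0 : q ≠ 0) (hq : ‖q‖ < 1) :
    rogersRamanujan r q = r * ramF (-q ^ 4) (-q) / ramF (-q ^ 3) (-q ^ 2) :=
  (tendsto_rogersRamanujanFract r hq0 hq).limUnder_eq

/-! ### Products modulo 10. -/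

/-- `(q^a, q^(10-a); q^10)_∞`. -/
noncomputable def pochA (a : ℕ) (q : ℂ) : ℂ := qPoch (q ^ a) (q ^ 10) * qPoch (q ^ (10 - a)) (q ^ 10)

/-- `(-q^a, -q^(10-a); q^10)_∞`. -/
noncomputable def pochB (a : ℕ) (q : ℂ) : ℂ :=
  qPoch (-q ^ a) (q ^ 10) * qPoch (-q ^ (10 - a)) (q ^ 10)

/-- `(q^a; q^10)_∞`. -/
noncomputable def pochP (a : ℕ) (q : ℂ) : ℂ := qPoch (q ^ a) (q ^ 10)

/-- `(-q^a; q^10)_∞`. -/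
noncomputable def pochM (a : ℕ) (q : ℂ) : ℂ := qPoch (-q ^ a) (q ^ 10)

theorem norm_pow_lt_one {q : ℂ} (hq : ‖q‖ < 1) {n : ℕ} (hn : n ≠ 0) : ‖q ^ n‖ < 1 := by
  rw [norm_pow]; exact pow_lt_one₀ (norm_nonneg _) hq hn

theorem norm_neg_pow_lt_one {q : ℂ} (hq : ‖q‖ < 1) {n : ℕ} (hn : n ≠ 0) : ‖-q ^ n‖ < 1 := by
  rw [norm_neg]; exact norm_pow_lt_one hq hn

theorem pochP_ne_zero {q : ℂ} (hq : ‖q‖ < 1) {a : ℕ} (ha : a ≠ 0) : pochP a q ≠ 0 :=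
  qPoch_ne_zero_of_norm_lt_one (norm_pow_lt_one hq (by norm_num)) (norm_pow_lt_one hq ha)

theorem pochM_ne_zero {q : ℂ} (hq : ‖q‖ < 1) {a : ℕ} (ha : a ≠ 0) : pochM a q ≠ 0 :=
  qPoch_ne_zero_of_norm_lt_one (norm_pow_lt_one hq (by norm_num)) (norm_neg_pow_lt_one hq ha)

theorem pochA_ne_zero {q : ℂ} (hq : ‖q‖ < 1) {a : ℕ} (ha : a ≠ 0) (ha' : 10 - a ≠ 0) :
    pochA a q ≠ 0 :=
  mul_ne_zero (pochP_ne_zero hq ha) (pochP_ne_zero hq ha')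

theorem pochB_ne_zero {q : ℂ} (hq : ‖q‖ < 1) {a : ℕ} (ha : a ≠ 0) (ha' : 10 - a ≠ 0) :
    pochB a q ≠ 0 :=
  mul_ne_zero (pochM_ne_zero hq ha) (pochM_ne_zero hq ha')

theorem qPoch_pow_five {q : ℂ} (hq : ‖q‖ < 1) (x : ℂ) :
    qPoch x (q ^ 5) = qPoch x (q ^ 10) * qPoch (x * q ^ 5) (q ^ 10) := by
  rw [qPoch_split x (norm_pow_lt_one hq (by norm_num : 5 ≠ 0)) 2, Fin.prod_univ_two,
    show (q ^ 5) ^ 2 = q ^ 10 by ring]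
  simp

theorem qPoch_pow_ten {q : ℂ} (hq : ‖q‖ < 1) (x : ℂ) :
    qPoch (x ^ 2) (q ^ 10) = (qPoch x (q ^ 10) * qPoch (x * q ^ 5) (q ^ 10))
      * (qPoch (-x) (q ^ 10) * qPoch (-(x * q ^ 5)) (q ^ 10)) := by
  rw [← qPoch_pow_five hq, ← neg_mul, ← qPoch_pow_five hq,
    qPoch_mul_neg x (norm_pow_lt_one hq (by norm_num)), show (q ^ 5) ^ 2 = q ^ 10 by ring]

theorem qPoch_pow_two {q : ℂ} (hq : ‖q‖ < 1) (x : ℂ) :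
    qPoch x (q ^ 2) = qPoch x (q ^ 10) * qPoch (x * q ^ 2) (q ^ 10) * qPoch (x * q ^ 4) (q ^ 10)
      * qPoch (x * q ^ 6) (q ^ 10) * qPoch (x * q ^ 8) (q ^ 10) := by
  rw [qPoch_split x (norm_pow_lt_one hq (by norm_num : 2 ≠ 0)) 5, Fin.prod_univ_five,
    show (q ^ 2) ^ 5 = q ^ 10 by ring]
  simp only [Fin.val_zero, Fin.val_one, Fin.val_two, pow_zero, mul_one, ← pow_mul]
  rfl

/-- The duplication `qPoch_pow_ten` at `x = q` and `x = q^4`. With `pochA_four` it eliminates `pochB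
4` and `pochB 3`, after which the multiplicative identities below are cancellations. -/
theorem pochA_two {q : ℂ} (hq : ‖q‖ < 1) : pochA 2 q = pochA 1 q * pochA 4 q * (pochB 1 q * pochB 4 q) := by
  have h1 := qPoch_pow_ten hq q
  have h2 := qPoch_pow_ten hq (q ^ 4)
  simp only [pochA, pochB]
  norm_num only at *
  rw [show q * q ^ 5 = q ^ 6 by ring] at h1
  rw [show q ^ 4 * q ^ 5 = q ^ 9 by ring, show (q ^ 4) ^ 2 = q ^ 8 by ring] at h2
  rw [h1, h2, pow_one]; ring

theorem pochA_four {q : ℂ} (hq : ‖q‖ < 1) : pochA 4 q = pochA 2 q * pochA 3 q * (pochB 2 q * pochB 3 q) := by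
  have h1 := qPoch_pow_ten hq (q ^ 2)
  have h2 := qPoch_pow_ten hq (q ^ 3)
  simp only [pochA, pochB]
  norm_num only at *
  rw [show q ^ 2 * q ^ 5 = q ^ 7 by ring, show (q ^ 2) ^ 2 = q ^ 4 by ring] at h1
  rw [show q ^ 3 * q ^ 5 = q ^ 8 by ring, show (q ^ 3) ^ 2 = q ^ 6 by ring] at h2
  rw [h1, h2]; ring

/-- Euler's identity in base `q^5`: duplicate at `x = q^5` and cancel `(q^10; q^10)_∞`. -/
theorem pochP_five_mul {q : ℂ} (hq : ‖q‖ < 1) : pochP 5 q * pochM 5 q * pochM 10 q = 1 := by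
  have h1 := qPoch_pow_ten hq (q ^ 5)
  rw [show q ^ 5 * q ^ 5 = q ^ 10 by ring, show (q ^ 5) ^ 2 = q ^ 10 by ring] at h1
  apply mul_left_cancel₀ (pochP_ne_zero hq (by norm_num : 10 ≠ 0))
  simp only [pochP, pochM]
  linear_combination -h1

theorem ramF_comm (a b : ℂ) : ramF a b = ramF b a := by
  rw [ramF, ramF, mul_comm a b, mul_comm (qPoch (-a) _)]

theorem ramF_five_neg {q : ℂ} (hq : ‖q‖ < 1) {a b : ℕ} (h : a + b = 5) : ramF (-q ^ a) (-q ^ b)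
    = pochA a q * pochA b q * (pochP 5 q * pochP 10 q) := by
  have e : -q ^ a * -q ^ b = q ^ 5 := by rw [neg_mul_neg, ← pow_add, h]
  rw [ramF, e, qPoch_pow_five hq, qPoch_pow_five hq, qPoch_pow_five hq, neg_neg, neg_neg]
  simp only [pochA, pochP, ← pow_add]
  rw [show 10 - a = b + 5 by omega, show 10 - b = a + 5 by omega]; ring

theorem ramF_five_pos {q : ℂ} (hq : ‖q‖ < 1) {a b : ℕ} (h : a + b = 5) : ramF (q ^ a) (q ^ b)
    = pochB a q * pochB b q * (pochP 5 q * pochP 10 q) := by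
  have e : q ^ a * q ^ b = q ^ 5 := by rw [← pow_add, h]
  rw [ramF, e, qPoch_pow_five hq, qPoch_pow_five hq, qPoch_pow_five hq]
  simp only [pochB, pochP, neg_mul, ← pow_add]
  rw [show 10 - a = b + 5 by omega, show 10 - b = a + 5 by omega]; ring

theorem ramF_ten_neg (q : ℂ) {a b : ℕ} (h : a + b = 10) : ramF (-q ^ a) (-q ^ b)
    = pochA a q * pochP 10 q := by
  have e : -q ^ a * -q ^ b = q ^ 10 := by rw [neg_mul_neg, ← pow_add, h]
  rw [ramF, e, neg_neg, neg_neg, pochA, pochP, show 10 - a = b by omega]; ring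

theorem ramF_ten_pos (q : ℂ) {a b : ℕ} (h : a + b = 10) : ramF (q ^ a) (q ^ b)
    = pochB a q * pochP 10 q := by
  have e : q ^ a * q ^ b = q ^ 10 := by rw [← pow_add, h]
  rw [ramF, e, pochB, pochP, show 10 - a = b by omega]; ring

theorem ramF_twenty_neg {q : ℂ} (hq : ‖q‖ < 1) {a b : ℕ} (h : a + b = 10) : ramF (-q ^ (2 * a)) (-q ^ (2 * b))
    = pochA a q * pochB a q * (pochP 10 q * pochM 10 q) := by
  have h10 := norm_pow_lt_one hq (by norm_num : 10 ≠ 0)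
  have e : -q ^ (2 * a) * -q ^ (2 * b) = (q ^ 10) ^ 2 := by
    rw [neg_mul_neg, ← pow_add, ← pow_mul]; congr 1; omega
  rw [ramF, e, neg_neg, neg_neg, mul_comm 2 a, mul_comm 2 b, pow_mul, pow_mul,
    ← qPoch_mul_neg _ h10, ← qPoch_mul_neg _ h10, ← qPoch_mul_neg _ h10,
    pochA, pochB, pochP, pochM, show 10 - a = b by omega]
  ring

theorem pochA_sq {q : ℂ} (hq : ‖q‖ < 1) (a : ℕ) : pochA a (q ^ 2) = pochA a q * pochB a q := by
  have h10 := norm_pow_lt_one hq (by norm_num : 10 ≠ 0)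
  simp only [pochA, pochB, pow_right_comm q 2]
  rw [← qPoch_mul_neg _ h10, ← qPoch_mul_neg _ h10]; ring

theorem pochA_neg_of_odd (q : ℂ) {a : ℕ} (h : Odd a) (h' : Odd (10 - a)) :
    pochA a (-q) = pochB a q ∧ pochB a (-q) = pochA a q := by
  simp only [pochA, pochB, h.neg_pow, h'.neg_pow, Even.neg_pow (by decide : Even 10), neg_neg,
    and_self]

theorem pochA_neg_of_even (q : ℂ) {a : ℕ} (h : Even a) (h' : Even (10 - a)) :
    pochA a (-q) = pochA a q ∧ pochB a (-q) = pochB a q := by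
  simp only [pochA, pochB, h.neg_pow, h'.neg_pow, Even.neg_pow (by decide : Even 10),
    and_self]

theorem pochP_five_neg (q : ℂ) : pochP 5 (-q) = pochM 5 q := by
  simp only [pochP, pochM, Odd.neg_pow (by decide : Odd 5), Even.neg_pow (by decide : Even 10)]

/-! ### Additive identities between the products. -/

/-- The four choices of the signs `e`, `f` give the four identities that follow; these later factor
`1 ± R(q)R(q^4)` and `1 ± R(q)R(q^2)^2`. -/
theorem ramF_mul_five {q : ℂ} (hq : ‖q‖ < 1) (hq0 : q ≠ 0) {e f : ℂ} (he : e ^ 2 = 1) (hf : f ^ 2 = 1) :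
    ramF (e * q) (e * q ^ 4) * ramF (f * q ^ 2) (f * q ^ 3)
      = ramF (e * f * q ^ 3) (e * f * q ^ 7) * ramF (e * f * q ^ 4) (e * f * q ^ 6)
        + e * q * (ramF (e * f * q ^ 8) (e * f * q ^ 2) * ramF (e * f * q ^ 9) (e * f * q)) := by
  have he0 : e ≠ 0 := by rintro rfl; simp at he
  have hf0 : f ≠ 0 := by rintro rfl; simp at hf
  have hd : e / f = e * f := by field_simp; linear_combination -hf
  have h5 : e * q * (e * q ^ 4) = q ^ 5 := by linear_combination q ^ 5 * he
  have := ramF_mul_ramF (a := e * q) (b := e * q ^ 4) (c := f * q ^ 2) (d := f * q ^ 3)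
    (mul_ne_zero he0 hq0) (mul_ne_zero he0 (pow_ne_zero _ hq0)) (mul_ne_zero hf0 (pow_ne_zero _ hq0))
    (mul_ne_zero hf0 (pow_ne_zero _ hq0)) (by linear_combination q ^ 5 * he - q ^ 5 * hf)
    (by rw [h5]; exact norm_pow_lt_one hq (by norm_num))
  rw [this, show e * q * (f * q ^ 2) = e * f * q ^ 3 by ring,
    show e * q ^ 4 * (f * q ^ 3) = e * f * q ^ 7 by ring,
    show e * q * (f * q ^ 3) = e * f * q ^ 4 by ring,
    show e * q ^ 4 * (f * q ^ 2) = e * f * q ^ 6 by ring,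
    show e * q * (f * q ^ 2) ^ 2 * (f * q ^ 3) = e * f * q ^ 8 by
      linear_combination e * f * q ^ 8 * hf,
    show e * f * q ^ 3 * (f * q ^ 3) ^ 2 = e * f * q ^ 9 by
      linear_combination e * f * q ^ 9 * hf,
    show e * q ^ 4 / (f * q ^ 2) = e * f * q ^ 2 by rw [← hd]; field_simp,
    show e * q ^ 4 / (f * q ^ 3) = e * f * q by rw [← hd]; field_simp]

theorem pochA_mul_add {q : ℂ} (hq : ‖q‖ < 1) (hq0 : q ≠ 0) :
    pochA 3 q * pochA 4 q + q * (pochA 1 q * pochA 2 q)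
      = pochB 1 q * pochB 4 q * (pochA 2 q * pochA 3 q) * pochP 5 q ^ 2 := by
  have h := ramF_mul_five hq hq0 (e := 1) (f := -1) (by norm_num) (by norm_num)
  have p1 := ramF_five_pos hq (a := 1) (b := 4) rfl
  have p2 := ramF_five_neg hq (a := 2) (b := 3) rfl
  have t1 := ramF_ten_neg q (a := 1) (b := 9) rfl
  have t2 := ramF_ten_neg q (a := 2) (b := 8) rfl
  have t3 := ramF_ten_neg q (a := 3) (b := 7) rfl
  have t4 := ramF_ten_neg q (a := 4) (b := 6) rfl
  simp only [one_mul, neg_mul, pow_one] at h p1 t1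
  rw [ramF_comm (-q ^ 8), ramF_comm (-q ^ 9), p1, p2, t1, t2, t3, t4] at h
  apply mul_left_cancel₀ (pow_ne_zero 2 (pochP_ne_zero hq (by norm_num : 10 ≠ 0)))
  linear_combination -h

theorem pochA_mul_sub {q : ℂ} (hq : ‖q‖ < 1) (hq0 : q ≠ 0) :
    pochA 3 q * pochA 4 q - q * (pochA 1 q * pochA 2 q)
      = pochA 1 q * pochA 4 q * (pochB 2 q * pochB 3 q) * pochP 5 q ^ 2 := by
  have h := ramF_mul_five hq hq0 (e := -1) (f := 1) (by norm_num) (by norm_num)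
  have p1 := ramF_five_neg hq (a := 1) (b := 4) rfl
  have p2 := ramF_five_pos hq (a := 2) (b := 3) rfl
  have t1 := ramF_ten_neg q (a := 1) (b := 9) rfl
  have t2 := ramF_ten_neg q (a := 2) (b := 8) rfl
  have t3 := ramF_ten_neg q (a := 3) (b := 7) rfl
  have t4 := ramF_ten_neg q (a := 4) (b := 6) rfl
  simp only [one_mul, neg_mul, pow_one, mul_one] at h p1 t1
  rw [ramF_comm (-q ^ 8), ramF_comm (-q ^ 9), p1, p2, t1, t2, t3, t4] at h
  apply mul_left_cancel₀ (pow_ne_zero 2 (pochP_ne_zero hq (by norm_num : 10 ≠ 0)))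
  linear_combination -h

theorem pochB_mul_add {q : ℂ} (hq : ‖q‖ < 1) (hq0 : q ≠ 0) :
    pochB 3 q * pochB 4 q + q * (pochB 1 q * pochB 2 q)
      = pochB 1 q * pochB 4 q * (pochB 2 q * pochB 3 q) * pochP 5 q ^ 2 := by
  have h := ramF_mul_five hq hq0 (e := 1) (f := 1) (by norm_num) (by norm_num)
  have p1 := ramF_five_pos hq (a := 1) (b := 4) rfl
  have p2 := ramF_five_pos hq (a := 2) (b := 3) rfl
  have t1 := ramF_ten_pos q (a := 1) (b := 9) rfl
  have t2 := ramF_ten_pos q (a := 2) (b := 8) rfl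
  have t3 := ramF_ten_pos q (a := 3) (b := 7) rfl
  have t4 := ramF_ten_pos q (a := 4) (b := 6) rfl
  simp only [one_mul, pow_one] at h p1 t1
  rw [ramF_comm (q ^ 8), ramF_comm (q ^ 9), p1, p2, t1, t2, t3, t4] at h
  apply mul_left_cancel₀ (pow_ne_zero 2 (pochP_ne_zero hq (by norm_num : 10 ≠ 0)))
  linear_combination -h

theorem pochB_mul_sub {q : ℂ} (hq : ‖q‖ < 1) (hq0 : q ≠ 0) :
    pochB 3 q * pochB 4 q - q * (pochB 1 q * pochB 2 q)
      = pochA 1 q * pochA 4 q * (pochA 2 q * pochA 3 q) * pochP 5 q ^ 2 := by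
  have h := ramF_mul_five hq hq0 (e := -1) (f := -1) (by norm_num) (by norm_num)
  have p1 := ramF_five_neg hq (a := 1) (b := 4) rfl
  have p2 := ramF_five_neg hq (a := 2) (b := 3) rfl
  have t1 := ramF_ten_pos q (a := 1) (b := 9) rfl
  have t2 := ramF_ten_pos q (a := 2) (b := 8) rfl
  have t3 := ramF_ten_pos q (a := 3) (b := 7) rfl
  have t4 := ramF_ten_pos q (a := 4) (b := 6) rfl
  simp only [one_mul, neg_mul, pow_one, neg_neg] at h p1 t1
  rw [ramF_comm (q ^ 8), ramF_comm (q ^ 9), p1, p2, t1, t2, t3, t4] at h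
  apply mul_left_cancel₀ (pow_ne_zero 2 (pochP_ne_zero hq (by norm_num : 10 ≠ 0)))
  linear_combination -h

/-- Serves to factor `R(q) ± R(-q)`: the resulting identity and its image under `q ↦ -q` differ only
in the sign of the term with `q`, so their sum and difference are single products. -/
theorem ramF_mul_ten {q : ℂ} (hq : ‖q‖ < 1) (hq0 : q ≠ 0) {e : ℂ} (he : e ^ 2 = 1) :
    ramF (e * q) (e * q ^ 9) * ramF (-(e * q ^ 3)) (-(e * q ^ 7))
      = ramF (-q ^ 4) (-q ^ 16) * ramF (-q ^ 8) (-q ^ 12)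
        + e * q * (ramF (-q ^ 14) (-q ^ 6) * ramF (-q ^ 18) (-q ^ 2)) := by
  have he0 : e ≠ 0 := by rintro rfl; simp at he
  have h10 : e * q * (e * q ^ 9) = q ^ 10 := by linear_combination q ^ 10 * he
  have := ramF_mul_ramF (a := e * q) (b := e * q ^ 9) (c := -(e * q ^ 3)) (d := -(e * q ^ 7))
    (mul_ne_zero he0 hq0) (mul_ne_zero he0 (pow_ne_zero _ hq0))
    (neg_ne_zero.2 (mul_ne_zero he0 (pow_ne_zero _ hq0)))
    (neg_ne_zero.2 (mul_ne_zero he0 (pow_ne_zero _ hq0))) (by ring)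
    (by rw [h10]; exact norm_pow_lt_one hq (by norm_num))
  rw [this, show e * q * -(e * q ^ 3) = -q ^ 4 by linear_combination -q ^ 4 * he,
    show e * q ^ 9 * -(e * q ^ 7) = -q ^ 16 by linear_combination -q ^ 16 * he,
    show e * q * -(e * q ^ 7) = -q ^ 8 by linear_combination -q ^ 8 * he,
    show e * q ^ 9 * -(e * q ^ 3) = -q ^ 12 by linear_combination -q ^ 12 * he,
    show e * q * (-(e * q ^ 3)) ^ 2 * -(e * q ^ 7) = -q ^ 14 by
      linear_combination -q ^ 14 * (e ^ 2 + 1) * he,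
    show -q ^ 4 * (-(e * q ^ 7)) ^ 2 = -q ^ 18 by
      linear_combination -q ^ 18 * he,
    show e * q ^ 9 / -(e * q ^ 3) = -q ^ 6 by field_simp,
    show e * q ^ 9 / -(e * q ^ 7) = -q ^ 2 by field_simp]

theorem pochB_one_mul_pochA_three {q : ℂ} (hq : ‖q‖ < 1) (hq0 : q ≠ 0) :
    pochB 1 q * pochA 3 q = pochM 10 q ^ 2 * (pochA 2 q * pochB 2 q * (pochA 4 q * pochB 4 q)
      + q * (pochA 1 q * pochB 1 q * (pochA 3 q * pochB 3 q))) := by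
  have h := ramF_mul_ten hq hq0 (e := 1) (by norm_num)
  have t1 := ramF_ten_pos q (a := 1) (b := 9) rfl
  have t3 := ramF_ten_neg q (a := 3) (b := 7) rfl
  have w1 := ramF_twenty_neg hq (a := 1) (b := 9) rfl
  have w2 := ramF_twenty_neg hq (a := 2) (b := 8) rfl
  have w3 := ramF_twenty_neg hq (a := 3) (b := 7) rfl
  have w4 := ramF_twenty_neg hq (a := 4) (b := 6) rfl
  norm_num only [one_mul, pow_one] at h t1 w1 w2 w3 w4
  rw [ramF_comm (-q ^ 14), ramF_comm (-q ^ 18), t1, t3, w1, w2, w3, w4] at h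
  apply mul_left_cancel₀ (pow_ne_zero 2 (pochP_ne_zero hq (by norm_num : 10 ≠ 0)))
  linear_combination h

theorem pochA_one_mul_pochB_three {q : ℂ} (hq : ‖q‖ < 1) (hq0 : q ≠ 0) :
    pochA 1 q * pochB 3 q = pochM 10 q ^ 2 * (pochA 2 q * pochB 2 q * (pochA 4 q * pochB 4 q)
      - q * (pochA 1 q * pochB 1 q * (pochA 3 q * pochB 3 q))) := by
  have h := pochB_one_mul_pochA_three (q := -q) (by rwa [norm_neg]) (neg_ne_zero.2 hq0)
  have h1 := pochA_neg_of_odd q (a := 1) (by decide) (by decide)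
  have h2 := pochA_neg_of_even q (a := 2) (by decide) (by decide)
  have h3 := pochA_neg_of_odd q (a := 3) (by decide) (by decide)
  have h4 := pochA_neg_of_even q (a := 4) (by decide) (by decide)
  have h5 : pochM 10 (-q) = pochM 10 q := by
    simp only [pochM, Even.neg_pow (by decide : Even 10)]
  rw [h1.1, h1.2, h2.1, h2.2, h3.1, h3.2, h4.1, h4.2, h5] at h
  linear_combination h

/-! ### The functions `φ` and `ψ` as products. -/

theorem qPoch_neg_one {q : ℂ} (hq : ‖q‖ < 1) : qPoch (-1) q = 2 * qPoch (-q) q := by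
  rw [qPoch_succ (-1) hq]; norm_num

theorem theta_one_eq {q : ℂ} (hq : ‖q‖ < 1) (hq0 : q ≠ 0) : theta q 1
    = pochA 2 q * pochA 4 q * pochP 10 q * (pochB 1 q * pochB 3 q * pochM 5 q) ^ 2 := by
  rw [theta_eq_ramF (a := q) (b := q) hq0 hq (by ring) (by ring) one_ne_zero, ramF, ← pow_two,
    qPoch_pow_two hq, qPoch_pow_two hq]
  simp only [pochA, pochB, pochP, pochM, neg_mul, ← pow_add, ← pow_succ']
  norm_num only [pow_one]
  ring

theorem theta_self_eq {q : ℂ} (hq : ‖q‖ < 1) (hq0 : q ≠ 0) : theta q q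
    = 2 * (pochA 2 q * pochA 4 q * pochP 10 q * (pochB 2 q * pochB 4 q * pochM 10 q) ^ 2) := by
  rw [theta_eq_ramF (a := q ^ 2) (b := 1) hq0 hq (by ring) (by field_simp) hq0, ramF, mul_one,
    qPoch_neg_one (norm_pow_lt_one hq two_ne_zero), qPoch_pow_two hq, qPoch_pow_two hq]
  simp only [pochA, pochB, pochP, pochM, neg_mul, ← pow_add]
  norm_num only
  ring

theorem theta_pow_five_one_eq {q : ℂ} (hq : ‖q‖ < 1) (hq0 : q ≠ 0) :
    theta (q ^ 5) 1 = pochP 10 q * pochM 5 q ^ 2 := by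
  rw [theta_eq_ramF (a := q ^ 5) (b := q ^ 5) (pow_ne_zero _ hq0) (norm_pow_lt_one hq (by norm_num))
    (by ring) (by ring) one_ne_zero, ramF, ← pow_add, pochP, pochM]
  ring

theorem theta_pow_five_self_eq {q : ℂ} (hq : ‖q‖ < 1) (hq0 : q ≠ 0) :
    theta (q ^ 5) (q ^ 5) = 2 * (pochP 10 q * pochM 10 q ^ 2) := by
  rw [theta_eq_ramF (a := q ^ 10) (b := 1) (pow_ne_zero _ hq0) (norm_pow_lt_one hq (by norm_num))
    (by ring) (by field_simp) (pow_ne_zero _ hq0), ramF, mul_one,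
    qPoch_neg_one (norm_pow_lt_one hq (by norm_num)), pochP, pochM]
  ring

/-! ### Product formulas for `R` at `q`, `-q`, `q^2` and `q^4`. -/

theorem pochB_four_eq {q : ℂ} (hq : ‖q‖ < 1) :
    pochB 4 q = pochA 2 q / (pochA 1 q * pochA 4 q * pochB 1 q) := by
  have h1 := pochA_ne_zero hq (a := 1) (by norm_num) (by norm_num)
  have h4 := pochA_ne_zero hq (a := 4) (by norm_num) (by norm_num)
  have h1' := pochB_ne_zero hq (a := 1) (by norm_num) (by norm_num)
  rw [pochA_two hq]; field_simp

theorem pochB_three_eq {q : ℂ} (hq : ‖q‖ < 1) :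
    pochB 3 q = pochA 4 q / (pochA 2 q * pochA 3 q * pochB 2 q) := by
  have h1 := pochA_ne_zero hq (a := 2) (by norm_num) (by norm_num)
  have h4 := pochA_ne_zero hq (a := 3) (by norm_num) (by norm_num)
  have h1' := pochB_ne_zero hq (a := 2) (by norm_num) (by norm_num)
  rw [pochA_four hq]; field_simp

theorem rogersRamanujan_eq_poch (r : ℂ) {q : ℂ} (hq : ‖q‖ < 1) (hq0 : q ≠ 0) :
    rogersRamanujan r q = r * (pochA 1 q * pochA 4 q) / (pochA 2 q * pochA 3 q) := by
  have h := ramF_five_neg hq (a := 4) (b := 1) rfl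
  rw [pow_one] at h
  have h5 := pochP_ne_zero hq (by norm_num : 5 ≠ 0)
  have h10 := pochP_ne_zero hq (by norm_num : 10 ≠ 0)
  rw [rogersRamanujan_eq r hq0 hq, h, ramF_five_neg hq rfl]
  field_simp

theorem rogersRamanujan_sq (r : ℂ) {q : ℂ} (hq : ‖q‖ < 1) (hq0 : q ≠ 0) :
    rogersRamanujan r (q ^ 2) = r * pochA 2 q / pochA 4 q := by
  have h1 := pochA_ne_zero hq (a := 1) (by norm_num) (by norm_num)
  have h2 := pochA_ne_zero hq (a := 2) (by norm_num) (by norm_num)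
  have h3 := pochA_ne_zero hq (a := 3) (by norm_num) (by norm_num)
  have h4 := pochA_ne_zero hq (a := 4) (by norm_num) (by norm_num)
  have h1' := pochB_ne_zero hq (a := 1) (by norm_num) (by norm_num)
  have h2' := pochB_ne_zero hq (a := 2) (by norm_num) (by norm_num)
  rw [rogersRamanujan_eq_poch r (norm_pow_lt_one hq two_ne_zero) (pow_ne_zero _ hq0),
    pochA_sq hq, pochA_sq hq, pochA_sq hq, pochA_sq hq, pochB_four_eq hq, pochB_three_eq hq]
  field_simp

theorem rogersRamanujan_four (r : ℂ) {q : ℂ} (hq : ‖q‖ < 1) (hq0 : q ≠ 0) :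
    rogersRamanujan r (q ^ 4) = r * (pochA 2 q * pochB 2 q) / (pochA 4 q * pochB 4 q) := by
  rw [show q ^ 4 = (q ^ 2) ^ 2 by ring,
    rogersRamanujan_sq r (norm_pow_lt_one hq two_ne_zero) (pow_ne_zero _ hq0),
    pochA_sq hq, pochA_sq hq]

theorem rogersRamanujan_neg (r : ℂ) {q : ℂ} (hq : ‖q‖ < 1) (hq0 : q ≠ 0) :
    rogersRamanujan r (-q) = r * (pochB 1 q * pochA 4 q) / (pochA 2 q * pochB 3 q) := by
  rw [rogersRamanujan_eq_poch r (by rwa [norm_neg]) (neg_ne_zero.2 hq0),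
    (pochA_neg_of_odd q (a := 1) (by decide) (by decide)).1,
    (pochA_neg_of_even q (a := 2) (by decide) (by decide)).1,
    (pochA_neg_of_odd q (a := 3) (by decide) (by decide)).1,
    (pochA_neg_of_even q (a := 4) (by decide) (by decide)).1]

theorem rogersRamanujan_ne_zero {r q : ℂ} (hr : r ≠ 0) (hq : ‖q‖ < 1) (hq0 : q ≠ 0) :
    rogersRamanujan r q ≠ 0 := by
  rw [rogersRamanujan_eq_poch r hq hq0]
  exact div_ne_zero (mul_ne_zero hr (mul_ne_zero (pochA_ne_zero hq (by norm_num) (by norm_num))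
    (pochA_ne_zero hq (by norm_num) (by norm_num))))
    (mul_ne_zero (pochA_ne_zero hq (by norm_num) (by norm_num))
      (pochA_ne_zero hq (by norm_num) (by norm_num)))

/-! ### The 5-dissections of `φ` and `ψ`. -/

theorem theta_one_dissection {q : ℂ} (hq : ‖q‖ < 1) (hq0 : q ≠ 0) :
    theta q 1 = theta (q ^ 25) 1 + 2 * q * ramF (q ^ 15) (q ^ 35)
      + 2 * q ^ 4 * ramF (q ^ 5) (q ^ 45) := by
  have h25 := norm_pow_lt_one hq (by norm_num : 25 ≠ 0)
  have e1 : theta (q ^ 25) (q ^ 10) = ramF (q ^ 15) (q ^ 35) := by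
    rw [ramF_comm]
    exact theta_eq_ramF (pow_ne_zero _ hq0) h25 (by ring) (by field_simp) (pow_ne_zero _ hq0)
  have e2 : theta (q ^ 25) (q ^ 20) = ramF (q ^ 5) (q ^ 45) := by
    rw [ramF_comm]
    exact theta_eq_ramF (pow_ne_zero _ hq0) h25 (by ring) (by field_simp) (pow_ne_zero _ hq0)
  have h := theta_dissection_five hq0 hq one_ne_zero
  rw [Fin.sum_univ_five] at h
  norm_num [Fin.val_ofNat] at h
  rw [h, theta_inv, theta_inv, e1, e2]
  ring

/-- The exponent `n^2 + n` is symmetric under `n ↦ -1 - n`, so the residues `-1, 0` and `-2, 1` pair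
up while `2` stands alone. -/
theorem theta_self_dissection {q : ℂ} (hq : ‖q‖ < 1) (hq0 : q ≠ 0) :
    theta q q = 2 * ramF (q ^ 20) (q ^ 30) + 2 * q ^ 2 * ramF (q ^ 10) (q ^ 40)
      + q ^ 6 * theta (q ^ 25) (q ^ 25) := by
  have h25 := norm_pow_lt_one hq (by norm_num : 25 ≠ 0)
  have e1 : theta (q ^ 25) (q ^ 5) = ramF (q ^ 20) (q ^ 30) := by
    rw [ramF_comm]
    exact theta_eq_ramF (pow_ne_zero _ hq0) h25 (by ring) (by field_simp) (pow_ne_zero _ hq0)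
  have e2 : theta (q ^ 25) (q ^ 15) = ramF (q ^ 10) (q ^ 40) := by
    rw [ramF_comm]
    exact theta_eq_ramF (pow_ne_zero _ hq0) h25 (by ring) (by field_simp) (pow_ne_zero _ hq0)
  have h := theta_dissection_five hq0 hq hq0
  rw [Fin.sum_univ_five] at h
  norm_num [Fin.val_ofNat] at h
  rw [h]
  rw [show (q ^ 20)⁻¹ * q ^ 5 = (q ^ 15)⁻¹ by field_simp,
    show (q ^ 10)⁻¹ * q ^ 5 = (q ^ 5)⁻¹ by field_simp, ← pow_add, ← pow_add, theta_inv, theta_inv,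
    e1, e2]
  field_simp
  ring

/-! ### The modular equation for `R(q) R(q^4)`. -/

theorem rogersRamanujan_mul_neg (s : ℂ) {q : ℂ} (hq : ‖q‖ < 1) (hq0 : q ≠ 0) :
    rogersRamanujan s q * rogersRamanujan (-s) (-q) * rogersRamanujan (s ^ 2) (q ^ 2)
      = -rogersRamanujan (s ^ 4) (q ^ 4) := by
  have h1 := pochA_ne_zero hq (a := 1) (by norm_num) (by norm_num)
  have h2 := pochA_ne_zero hq (a := 2) (by norm_num) (by norm_num)
  have h3 := pochA_ne_zero hq (a := 3) (by norm_num) (by norm_num)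
  have h4 := pochA_ne_zero hq (a := 4) (by norm_num) (by norm_num)
  have h1' := pochB_ne_zero hq (a := 1) (by norm_num) (by norm_num)
  have h2' := pochB_ne_zero hq (a := 2) (by norm_num) (by norm_num)
  rw [rogersRamanujan_eq_poch s hq hq0, rogersRamanujan_neg _ hq hq0, rogersRamanujan_sq _ hq hq0,
    rogersRamanujan_four _ hq hq0, pochB_three_eq hq, pochB_four_eq hq]
  field_simp

/-- The product `R(q)R(q^4)` equals `q A_1 B_2 / (A_3 B_4)` with `A = pochA`, `B = pochB`, and
`pochB_mul_add` at `-q` factors `A_3 B_4 - q A_1 B_2`. -/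
theorem one_sub_mul_four {q s : ℂ} (hq : ‖q‖ < 1) (hq0 : q ≠ 0) (hs : s ^ 5 = q) :
    1 - rogersRamanujan s q * rogersRamanujan (s ^ 4) (q ^ 4)
      = pochA 1 q * pochB 2 q * pochM 5 q ^ 2 := by
  have hh := pochB_mul_add (q := -q) (by rwa [norm_neg]) (neg_ne_zero.2 hq0)
  have n1 := pochA_neg_of_odd q (a := 1) (by decide) (by decide)
  have n2 := pochA_neg_of_even q (a := 2) (by decide) (by decide)
  have n3 := pochA_neg_of_odd q (a := 3) (by decide) (by decide)
  have n4 := pochA_neg_of_even q (a := 4) (by decide) (by decide)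
  rw [n1.2, n2.2, n3.2, n4.2, pochP_five_neg] at hh
  have h1 := pochA_ne_zero hq (a := 1) (by norm_num) (by norm_num)
  have h2 := pochA_ne_zero hq (a := 2) (by norm_num) (by norm_num)
  have h3 := pochA_ne_zero hq (a := 3) (by norm_num) (by norm_num)
  have h4 := pochA_ne_zero hq (a := 4) (by norm_num) (by norm_num)
  have h2' := pochB_ne_zero hq (a := 2) (by norm_num) (by norm_num)
  have h4' := pochB_ne_zero hq (a := 4) (by norm_num) (by norm_num)
  rw [rogersRamanujan_eq_poch s hq hq0, rogersRamanujan_four _ hq hq0]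
  field_simp
  linear_combination hh - pochA 1 q * pochB 2 q * hs

theorem one_add_mul_four {q s : ℂ} (hq : ‖q‖ < 1) (hq0 : q ≠ 0) (hs : s ^ 5 = q) :
    1 + rogersRamanujan s q * rogersRamanujan (s ^ 4) (q ^ 4)
      = pochA 4 q * pochB 1 q * pochA 2 q * pochB 3 q / (pochA 3 q * pochB 4 q) * pochM 5 q ^ 2 := by
  have hh := pochB_mul_sub (q := -q) (by rwa [norm_neg]) (neg_ne_zero.2 hq0)
  have n1 := pochA_neg_of_odd q (a := 1) (by decide) (by decide)
  have n2 := pochA_neg_of_even q (a := 2) (by decide) (by decide)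
  have n3 := pochA_neg_of_odd q (a := 3) (by decide) (by decide)
  have n4 := pochA_neg_of_even q (a := 4) (by decide) (by decide)
  rw [n1.1, n1.2, n2.1, n2.2, n3.1, n3.2, n4.1, n4.2, pochP_five_neg] at hh
  have h1 := pochA_ne_zero hq (a := 1) (by norm_num) (by norm_num)
  have h2 := pochA_ne_zero hq (a := 2) (by norm_num) (by norm_num)
  have h3 := pochA_ne_zero hq (a := 3) (by norm_num) (by norm_num)
  have h4 := pochA_ne_zero hq (a := 4) (by norm_num) (by norm_num)
  have h4' := pochB_ne_zero hq (a := 4) (by norm_num) (by norm_num)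
  rw [rogersRamanujan_eq_poch s hq hq0, rogersRamanujan_four _ hq hq0]
  field_simp
  linear_combination hh + pochA 1 q * pochB 2 q * hs

theorem theta_one_mul {q s : ℂ} (hq : ‖q‖ < 1) (hq0 : q ≠ 0) (hs : s ^ 5 = q) :
    theta q 1 * (1 - rogersRamanujan s q * rogersRamanujan (s ^ 4) (q ^ 4))
      = theta (q ^ 5) 1 * (1 + rogersRamanujan s q * rogersRamanujan (s ^ 4) (q ^ 4)) := by
  have h1 := pochA_ne_zero hq (a := 1) (by norm_num) (by norm_num)
  have h2 := pochA_ne_zero hq (a := 2) (by norm_num) (by norm_num)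
  have h3 := pochA_ne_zero hq (a := 3) (by norm_num) (by norm_num)
  have h4 := pochA_ne_zero hq (a := 4) (by norm_num) (by norm_num)
  have h1' := pochB_ne_zero hq (a := 1) (by norm_num) (by norm_num)
  have h2' := pochB_ne_zero hq (a := 2) (by norm_num) (by norm_num)
  rw [one_sub_mul_four hq hq0 hs, one_add_mul_four hq hq0 hs, theta_one_eq hq hq0,
    theta_pow_five_one_eq hq hq0, pochB_three_eq hq, pochB_four_eq hq]
  field_simp

/-- `f(q^3, q^7)` in terms of Rogers-Ramanujan continued fractions. -/
theorem ramF_three_seven {q s : ℂ} (hq : ‖q‖ < 1) (hq0 : q ≠ 0) (hs : s ^ 5 = q) :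
    theta (q ^ 5) 1 * rogersRamanujan s q
      = s * (1 - rogersRamanujan s q * rogersRamanujan (s ^ 4) (q ^ 4)) * ramF (q ^ 3) (q ^ 7) := by
  have h1 := pochA_ne_zero hq (a := 1) (by norm_num) (by norm_num)
  have h2 := pochA_ne_zero hq (a := 2) (by norm_num) (by norm_num)
  have h3 := pochA_ne_zero hq (a := 3) (by norm_num) (by norm_num)
  have h4 := pochA_ne_zero hq (a := 4) (by norm_num) (by norm_num)
  have h1' := pochB_ne_zero hq (a := 1) (by norm_num) (by norm_num)
  have h2' := pochB_ne_zero hq (a := 2) (by norm_num) (by norm_num)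
  have h4' := pochB_ne_zero hq (a := 4) (by norm_num) (by norm_num)
  rw [one_sub_mul_four hq hq0 hs, theta_pow_five_one_eq hq hq0, ramF_ten_pos q rfl,
    rogersRamanujan_eq_poch s hq hq0]
  rw [pochB_three_eq hq]
  field_simp

theorem ramF_one_nine {q s : ℂ} (hq : ‖q‖ < 1) (hq0 : q ≠ 0) (hs : s ^ 5 = q) :
    theta (q ^ 5) 1 * rogersRamanujan (s ^ 4) (q ^ 4)
      = s ^ 4 * (1 - rogersRamanujan s q * rogersRamanujan (s ^ 4) (q ^ 4)) * ramF q (q ^ 9) := by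
  have h1 := pochA_ne_zero hq (a := 1) (by norm_num) (by norm_num)
  have h2 := pochA_ne_zero hq (a := 2) (by norm_num) (by norm_num)
  have h3 := pochA_ne_zero hq (a := 3) (by norm_num) (by norm_num)
  have h4 := pochA_ne_zero hq (a := 4) (by norm_num) (by norm_num)
  have h1' := pochB_ne_zero hq (a := 1) (by norm_num) (by norm_num)
  have h2' := pochB_ne_zero hq (a := 2) (by norm_num) (by norm_num)
  have e := ramF_ten_pos q (a := 1) (b := 9) rfl
  rw [pow_one] at e
  rw [one_sub_mul_four hq hq0 hs, theta_pow_five_one_eq hq hq0, e, rogersRamanujan_four _ hq hq0,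
    pochB_four_eq hq]
  field_simp

/-- The quintic modular equation for `R(q) R(q^4)`. -/
theorem mul_four_quintic {q s : ℂ} (hq : ‖q‖ < 1) (hq0 : q ≠ 0) (hs : s ^ 5 = q) {z U X : ℂ}
    (hz : z = rogersRamanujan s q * rogersRamanujan (s ^ 4) (q ^ 4))
    (hU : U = rogersRamanujan (s ^ 5) (q ^ 5)) (hX : X = rogersRamanujan (s ^ 20) (q ^ 20)) :
    1 + U + X ≠ 0 ∧ z * (1 + U + X) = U + X - U * X := by
  have hq5 := norm_pow_lt_one hq (by norm_num : 5 ≠ 0)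
  have hq50 := pow_ne_zero 5 hq0
  have hs5 : (s ^ 5) ^ 5 = q ^ 5 := by rw [hs]
  have a1 := theta_one_mul hq hq0 hs
  have a2 := theta_one_mul hq5 hq50 hs5
  have a3 := ramF_three_seven hq5 hq50 hs5
  have a4 := ramF_one_nine hq5 hq50 hs5
  have a5 := one_add_mul_four hq5 hq50 hs5
  have a6 := theta_one_dissection hq hq0
  have hth : theta ((q ^ 5) ^ 5) 1 ≠ 0 := by
    rw [theta_pow_five_one_eq hq5 hq50]
    exact mul_ne_zero (pochP_ne_zero hq5 (by norm_num)) (pow_ne_zero _ (pochM_ne_zero hq5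
      (by norm_num)))
  have h1UX : 1 + U * X ≠ 0 := by
    have := pochM_ne_zero hq5 (by norm_num : 5 ≠ 0)
    rw [hU, hX, show s ^ 20 = (s ^ 5) ^ 4 by ring, show q ^ 20 = (q ^ 5) ^ 4 by ring, a5]
    have n := fun a (h : a ≠ 0) (h' : 10 - a ≠ 0) => pochA_ne_zero hq5 h h'
    have n' := fun a (h : a ≠ 0) (h' : 10 - a ≠ 0) => pochB_ne_zero hq5 h h'
    refine mul_ne_zero (div_ne_zero (mul_ne_zero (mul_ne_zero (mul_ne_zero ?_ ?_) ?_) ?_)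
      (mul_ne_zero ?_ ?_)) (pow_ne_zero _ this)
    · exact n 4 (by norm_num) (by norm_num)
    · exact n' 1 (by norm_num) (by norm_num)
    · exact n 2 (by norm_num) (by norm_num)
    · exact n' 3 (by norm_num) (by norm_num)
    · exact n 3 (by norm_num) (by norm_num)
    · exact n' 4 (by norm_num) (by norm_num)
  simp only [← pow_mul] at a2 a3 a4 hth
  norm_num only at a2 a3 a4 hth
  rw [← hU, ← hX] at a2 a3 a4
  rw [← hz] at a1
  rw [hs] at a3 
  have hs20 : s ^ 20 = q ^ 4 := by rw [← hs]; ring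
  rw [hs20] at a4
  -- Both sides arise from `φ(q) / φ(q^25)`: the dissection gives `(1 - UX + 2U + 2X) / (1 - UX)`,
  -- and two uses of `theta_one_mul`, at `q` and `q^5`, give the other form.
  have key : (1 - U * X + 2 * U + 2 * X) * (1 - z) = (1 + U * X) * (1 + z) := by
    apply mul_left_cancel₀ hth
    linear_combination (1 - U * X) * a1 - (1 - z) * (1 - U * X) * a6
      + (1 + z) * a2 + 2 * (1 - z) * a3 + 2 * (1 - z) * a4
  have key2 : (1 + U + X) * (1 - z) = 1 + U * X := by linear_combination key / 2
  exact ⟨fun h => h1UX (by rw [← key2, h, zero_mul]), by linear_combination -key2⟩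

/-! ### The modular equation for `R(q) / R(-q)`. -/

theorem pochA_odd_mul_pochB_eq_one {q : ℂ} (hq : ‖q‖ < 1) :
    pochA 1 q * pochA 3 q * (pochB 1 q * pochB 3 q) * (pochB 2 q * pochB 4 q) = 1 := by
  have h := pochA_two hq
  have h2 := pochA_ne_zero hq (a := 2) (by norm_num) (by norm_num)
  rw [pochA_four hq] at h
  apply mul_left_cancel₀ h2
  linear_combination -h

theorem sub_rogersRamanujan_neg (s : ℂ) {q : ℂ} (hq : ‖q‖ < 1) (hq0 : q ≠ 0) :
    rogersRamanujan s q - rogersRamanujan (-s) (-q)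
      = 2 * s * pochA 4 q ^ 2 * pochB 2 q * pochB 4 q * pochM 10 q ^ 2
        / (pochA 3 q * pochB 3 q) := by
  have h2 := pochA_ne_zero hq (a := 2) (by norm_num) (by norm_num)
  have h3 := pochA_ne_zero hq (a := 3) (by norm_num) (by norm_num)
  have h3' := pochB_ne_zero hq (a := 3) (by norm_num) (by norm_num)
  rw [rogersRamanujan_eq_poch s hq hq0, rogersRamanujan_neg _ hq hq0]
  field_simp
  linear_combination s * pochA 4 q *
    (pochB_one_mul_pochA_three hq hq0 + pochA_one_mul_pochB_three hq hq0)

theorem add_rogersRamanujan_neg (s : ℂ) {q : ℂ} (hq : ‖q‖ < 1) (hq0 : q ≠ 0) :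
    rogersRamanujan s q + rogersRamanujan (-s) (-q)
      = -(2 * s * q * pochA 4 q / pochA 2 q * (pochA 1 q * pochB 1 q) * pochM 10 q ^ 2) := by
  have h2 := pochA_ne_zero hq (a := 2) (by norm_num) (by norm_num)
  have h3 := pochA_ne_zero hq (a := 3) (by norm_num) (by norm_num)
  have h3' := pochB_ne_zero hq (a := 3) (by norm_num) (by norm_num)
  rw [rogersRamanujan_eq_poch s hq hq0, rogersRamanujan_neg _ hq hq0]
  field_simp
  linear_combination s * pochA 4 q *
    (pochA_one_mul_pochB_three hq hq0 - pochB_one_mul_pochA_three hq hq0)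

theorem sub_mul_theta (s : ℂ) {q : ℂ} (hq : ‖q‖ < 1) (hq0 : q ≠ 0) :
    (rogersRamanujan s q - rogersRamanujan (-s) (-q)) * (q * theta (q ^ 5) (q ^ 5))
      = -((rogersRamanujan s q + rogersRamanujan (-s) (-q)) * theta q q) := by
  have h1 := pochA_ne_zero hq (a := 1) (by norm_num) (by norm_num)
  have h2 := pochA_ne_zero hq (a := 2) (by norm_num) (by norm_num)
  have h3 := pochA_ne_zero hq (a := 3) (by norm_num) (by norm_num)
  have h4 := pochA_ne_zero hq (a := 4) (by norm_num) (by norm_num)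
  have h1' := pochB_ne_zero hq (a := 1) (by norm_num) (by norm_num)
  have h2' := pochB_ne_zero hq (a := 2) (by norm_num) (by norm_num)
  rw [sub_rogersRamanujan_neg s hq hq0, add_rogersRamanujan_neg s hq hq0, theta_self_eq hq hq0,
    theta_pow_five_self_eq hq hq0, pochB_three_eq hq, pochB_four_eq hq]
  field_simp

theorem ramF_four_six {q s : ℂ} (hq : ‖q‖ < 1) (hq0 : q ≠ 0) (hs : s ^ 5 = q) :
    (rogersRamanujan s q + rogersRamanujan (-s) (-q)) * ramF (q ^ 4) (q ^ 6)
      = -(s ^ 6 * theta (q ^ 5) (q ^ 5)) := by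
  subst hs
  have h1 := pochA_ne_zero hq (a := 1) (by norm_num) (by norm_num)
  have h2 := pochA_ne_zero hq (a := 2) (by norm_num) (by norm_num)
  have h4 := pochA_ne_zero hq (a := 4) (by norm_num) (by norm_num)
  have h1' := pochB_ne_zero hq (a := 1) (by norm_num) (by norm_num)
  rw [add_rogersRamanujan_neg s hq hq0, theta_pow_five_self_eq hq hq0, ramF_ten_pos _ rfl,
    pochB_four_eq hq]
  field_simp

theorem ramF_two_eight {q s : ℂ} (hq : ‖q‖ < 1) (hq0 : q ≠ 0) (hs : s ^ 5 = q) :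
    (rogersRamanujan s q + rogersRamanujan (-s) (-q)) * ramF (q ^ 2) (q ^ 8)
      = rogersRamanujan s q * rogersRamanujan (-s) (-q) * s ^ 4 * theta (q ^ 5) (q ^ 5) := by
  subst hs
  have h1 := pochA_ne_zero hq (a := 1) (by norm_num) (by norm_num)
  have h2 := pochA_ne_zero hq (a := 2) (by norm_num) (by norm_num)
  have h3 := pochA_ne_zero hq (a := 3) (by norm_num) (by norm_num)
  have h4 := pochA_ne_zero hq (a := 4) (by norm_num) (by norm_num)
  have h2' := pochB_ne_zero hq (a := 2) (by norm_num) (by norm_num)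
  rw [add_rogersRamanujan_neg s hq hq0, theta_pow_five_self_eq hq hq0, ramF_ten_pos _ rfl,
    rogersRamanujan_eq_poch s hq hq0, rogersRamanujan_neg _ hq hq0, pochB_three_eq hq]
  field_simp

theorem theta_self_ne_zero {q : ℂ} (hq : ‖q‖ < 1) (hq0 : q ≠ 0) : theta q q ≠ 0 := by
  rw [theta_self_eq hq hq0]
  have h2 := pochA_ne_zero hq (a := 2) (by norm_num) (by norm_num)
  have h4 := pochA_ne_zero hq (a := 4) (by norm_num) (by norm_num)
  have h2' := pochB_ne_zero hq (a := 2) (by norm_num) (by norm_num)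
  have h4' := pochB_ne_zero hq (a := 4) (by norm_num) (by norm_num)
  have h10 := pochP_ne_zero hq (by norm_num : 10 ≠ 0)
  have h10' := pochM_ne_zero hq (by norm_num : 10 ≠ 0)
  simp [h2, h4, h2', h4', h10, h10']

/-- The quintic modular equation for `R(q) / R(-q)`. -/
theorem div_neg_quintic {q s : ℂ} (hq : ‖q‖ < 1) (hq0 : q ≠ 0) (hs : s ^ 5 = q) {u w U W : ℂ}
    (hu : u = rogersRamanujan s q) (hw : w = rogersRamanujan (-s) (-q))
    (hU : U = rogersRamanujan (s ^ 5) (q ^ 5)) (hW : W = rogersRamanujan (-s ^ 5) (-q ^ 5)) :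
    1 - W - U * W ≠ 0 ∧ u * (1 - W - U * W) = -(w * (1 - U - U * W)) := by
  have hq5 := norm_pow_lt_one hq (by norm_num : 5 ≠ 0)
  have hq50 := pow_ne_zero 5 hq0
  have hs0 : s ≠ 0 := by rintro rfl; exact hq0 (by rw [← hs]; simp)
  have hs50 : s ^ 5 ≠ 0 := pow_ne_zero 5 hs0
  have hs5 : (s ^ 5) ^ 5 = q ^ 5 := by rw [hs]
  have hu0 : u ≠ 0 := hu ▸ rogersRamanujan_ne_zero hs0 hq hq0
  have hw0 : w ≠ 0 := hw ▸ rogersRamanujan_ne_zero (neg_ne_zero.2 hs0) (by rwa [norm_neg])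
    (neg_ne_zero.2 hq0)
  have hU0 : U ≠ 0 := hU ▸ rogersRamanujan_ne_zero hs50 hq5 hq50
  have a1 := sub_mul_theta s hq hq0
  have a2 := sub_mul_theta (s ^ 5) hq5 hq50
  have a3 := ramF_four_six hq5 hq50 hs5
  have a4 := ramF_two_eight hq5 hq50 hs5
  have a5 := theta_self_dissection hq hq0
  have t5 := theta_self_ne_zero hq5 hq50
  have t25 := theta_self_ne_zero (norm_pow_lt_one hq5 (by norm_num : 5 ≠ 0)) (pow_ne_zero 5 hq50)
  rw [← hU, ← hW] at a2 a3 a4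
  rw [← hu, ← hw] at a1
  rw [hs] at a3 a4
  simp only [← pow_mul] at a2 a3 a4 t25
  norm_num only at a2 a3 a4 t25
  -- If `U = W`, the relation at `q^5` would force `(U + W) ψ(q^10) = 0`. A zero of `1 - W - UW`
  -- would force `U = W` through `key`.
  have hne : U ≠ W := by
    rintro rfl
    rw [sub_self, zero_mul] at a2
    exact mul_ne_zero (by rw [← two_mul]; exact mul_ne_zero two_ne_zero hU0) t5
      (neg_eq_zero.1 a2.symm)
  have key : u * (1 - W - U * W) = -(w * (1 - U - U * W)) := by
    apply mul_left_cancel₀ (mul_ne_zero (pow_ne_zero 6 hq0) t25)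
    linear_combination ((u - w) * q * a2 - (U + W) * a1 + (u + w) * (U + W) * a5
      + 2 * (u + w) * a3 + 2 * (u + w) * q ^ 2 * a4) / 2
  refine ⟨fun h => hne ?_, key⟩
  rw [h, mul_zero, eq_comm, neg_eq_zero, mul_eq_zero, or_iff_right hw0] at key
  linear_combination h - key

/-! ### The modular equations for `R(q)` and `R(q^2)`. -/

theorem one_sub_mul_sq {q s : ℂ} (hq : ‖q‖ < 1) (hq0 : q ≠ 0) (hs : s ^ 5 = q) :
    1 - rogersRamanujan s q * rogersRamanujan (s ^ 2) (q ^ 2) ^ 2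
      = pochA 1 q / pochA 3 q * (pochB 2 q * pochB 3 q) * pochP 5 q ^ 2 := by
  have hh := pochA_mul_sub hq hq0
  have h2 := pochA_ne_zero hq (a := 2) (by norm_num) (by norm_num)
  have h3 := pochA_ne_zero hq (a := 3) (by norm_num) (by norm_num)
  have h4 := pochA_ne_zero hq (a := 4) (by norm_num) (by norm_num)
  rw [rogersRamanujan_eq_poch s hq hq0, rogersRamanujan_sq _ hq hq0]
  field_simp
  linear_combination hh - pochA 1 q * pochA 2 q * hs

theorem one_add_mul_sq {q s : ℂ} (hq : ‖q‖ < 1) (hq0 : q ≠ 0) (hs : s ^ 5 = q) :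
    1 + rogersRamanujan s q * rogersRamanujan (s ^ 2) (q ^ 2) ^ 2
      = pochA 2 q / pochA 4 q * (pochB 1 q * pochB 4 q) * pochP 5 q ^ 2 := by
  have hh := pochA_mul_add hq hq0
  have h2 := pochA_ne_zero hq (a := 2) (by norm_num) (by norm_num)
  have h3 := pochA_ne_zero hq (a := 3) (by norm_num) (by norm_num)
  have h4 := pochA_ne_zero hq (a := 4) (by norm_num) (by norm_num)
  rw [rogersRamanujan_eq_poch s hq hq0, rogersRamanujan_sq _ hq hq0]
  field_simp
  linear_combination hh + pochA 1 q * pochA 2 q * hs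

/-- Rogers' modular equation relating `R(q)` and `R(q^2)`. -/
theorem rogers_modular_equation {q s : ℂ} (hq : ‖q‖ < 1) (hq0 : q ≠ 0) (hs : s ^ 5 = q) {u v : ℂ}
    (hu : u = rogersRamanujan s q) (hv : v = rogersRamanujan (s ^ 2) (q ^ 2)) :
    (1 - u * v ^ 2) * v = (1 + u * v ^ 2) * u ^ 2 := by
  subst hu hv
  rw [one_sub_mul_sq hq hq0 hs, one_add_mul_sq hq hq0 hs]
  have h1 := pochA_ne_zero hq (a := 1) (by norm_num) (by norm_num)
  have h2 := pochA_ne_zero hq (a := 2) (by norm_num) (by norm_num)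
  have h3 := pochA_ne_zero hq (a := 3) (by norm_num) (by norm_num)
  have h4 := pochA_ne_zero hq (a := 4) (by norm_num) (by norm_num)
  have h1' := pochB_ne_zero hq (a := 1) (by norm_num) (by norm_num)
  have h2' := pochB_ne_zero hq (a := 2) (by norm_num) (by norm_num)
  rw [rogersRamanujan_eq_poch s hq hq0, rogersRamanujan_sq _ hq hq0, pochB_three_eq hq,
    pochB_four_eq hq]
  field_simp

/-- Gauss's product `ψ(q^5) = (q^10; q^10)_∞ / (q^5; q^10)_∞`. As a theta series `2ψ(q)` has nome `t
= q^(1/2)`, whence the square root here and below. -/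
theorem theta_sqrt_mul_pochP {q t : ℂ} (ht : ‖t‖ < 1) (ht0 : t ≠ 0) (htq : t ^ 2 = q) :
    theta (t ^ 5) (t ^ 5) * pochP 5 q = 2 * pochP 10 q := by
  have hq : ‖q‖ < 1 := htq ▸ norm_pow_lt_one ht two_ne_zero
  have e : t ^ 10 = q ^ 5 := by rw [← htq]; ring
  have h := pochP_five_mul hq
  have h1 := qPoch_pow_five hq (q ^ 5)
  have h2 := qPoch_pow_five hq (-q ^ 5)
  rw [theta_pow_five_self_eq ht ht0, pochP, pochM, e, h1, h2, neg_mul, ← pow_add]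
  simp only [pochP, pochM] at *
  linear_combination 2 * qPoch (q ^ 10) (q ^ 10)
    * (1 + qPoch (q ^ 5) (q ^ 10) * qPoch (-q ^ 5) (q ^ 10) * qPoch (-q ^ 10) (q ^ 10)) * h

theorem ramF_one_four {q s t : ℂ} (ht : ‖t‖ < 1) (ht0 : t ≠ 0) (htq : t ^ 2 = q) (hs : s ^ 5 = q)
    {u v : ℂ} (hu : u = rogersRamanujan s q) (hv : v = rogersRamanujan (s ^ 2) (q ^ 2)) :
    2 * ramF q (q ^ 4) * v = s ^ 2 * (1 + u * v ^ 2) * theta (t ^ 5) (t ^ 5) := by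
  have hq : ‖q‖ < 1 := htq ▸ norm_pow_lt_one ht two_ne_zero
  have hq0 : q ≠ 0 := htq ▸ pow_ne_zero 2 ht0
  have e := theta_sqrt_mul_pochP ht ht0 htq
  have f := ramF_five_pos hq (a := 1) (b := 4) rfl
  rw [pow_one] at f
  have h4 := pochA_ne_zero hq (a := 4) (by norm_num) (by norm_num)
  subst hu hv
  rw [f, one_add_mul_sq hq hq0 hs, rogersRamanujan_sq _ hq hq0]
  field_simp
  linear_combination (-(pochB 1 q * pochB 4 q * pochP 5 q * s ^ 2 * pochA 2 q)) * e

theorem ramF_two_three {q s t : ℂ} (ht : ‖t‖ < 1) (ht0 : t ≠ 0) (htq : t ^ 2 = q) (hs : s ^ 5 = q)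
    {u v : ℂ} (hu : u = rogersRamanujan s q) (hv : v = rogersRamanujan (s ^ 2) (q ^ 2)) :
    2 * ramF (q ^ 2) (q ^ 3) * (u * v) = s ^ 3 * (1 - u * v ^ 2) * theta (t ^ 5) (t ^ 5) := by
  have hq : ‖q‖ < 1 := htq ▸ norm_pow_lt_one ht two_ne_zero
  have hq0 : q ≠ 0 := htq ▸ pow_ne_zero 2 ht0
  have e := theta_sqrt_mul_pochP ht ht0 htq
  have h2 := pochA_ne_zero hq (a := 2) (by norm_num) (by norm_num)
  have h3 := pochA_ne_zero hq (a := 3) (by norm_num) (by norm_num)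
  have h4 := pochA_ne_zero hq (a := 4) (by norm_num) (by norm_num)
  subst hu hv
  rw [ramF_five_pos hq rfl, one_sub_mul_sq hq hq0 hs, rogersRamanujan_eq_poch s hq hq0,
    rogersRamanujan_sq _ hq hq0]
  field_simp
  linear_combination (-(pochB 2 q * pochB 3 q * pochP 5 q * s ^ 3 * pochA 1 q)) * e

/-- `ψ(q)^2 - q ψ(q^5)^2 = f(q, q^4) f(q^2, q^3)`, with `q = t^2`. -/
theorem theta_sq_sub {q t : ℂ} (ht : ‖t‖ < 1) (ht0 : t ≠ 0) (htq : t ^ 2 = q) :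
    theta t t ^ 2 - q * theta (t ^ 5) (t ^ 5) ^ 2 = 4 * (ramF q (q ^ 4) * ramF (q ^ 2) (q ^ 3)) := by
  have f1 := ramF_ten_pos t (a := 2) (b := 8) rfl
  have f2 := ramF_ten_pos t (a := 4) (b := 6) rfl
  have e1 := pochB_one_mul_pochA_three ht ht0
  have e2 := pochA_one_mul_pochB_three ht ht0
  have e3 := pochA_odd_mul_pochB_eq_one ht
  rw [← htq, ← pow_mul, ← pow_mul, ← pow_mul, f1, f2, theta_self_eq ht ht0,
    theta_pow_five_self_eq ht ht0]
  have key : (pochA 1 t * pochA 3 t * (pochB 1 t * pochB 3 t)) = pochM 10 t ^ 4 *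
      ((pochA 2 t * pochB 2 t * (pochA 4 t * pochB 4 t)) ^ 2
        - t ^ 2 * (pochA 1 t * pochA 3 t * (pochB 1 t * pochB 3 t)) ^ 2) := by
    linear_combination pochA 1 t * pochB 3 t * e1 + pochM 10 t ^ 2
      * (pochA 2 t * pochB 2 t * (pochA 4 t * pochB 4 t)
      + t * (pochA 1 t * pochB 1 t * (pochA 3 t * pochB 3 t))) * e2
  generalize pochA 1 t * pochA 3 t * (pochB 1 t * pochB 3 t) = c at *
  linear_combination (-4 * pochP 10 t ^ 2 * (pochB 2 t * pochB 4 t) ^ 2) * key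
    + 4 * pochP 10 t ^ 2 * (pochB 2 t * pochB 4 t
      + t ^ 2 * pochM 10 t ^ 4 * (c * (pochB 2 t * pochB 4 t) + 1)) * e3

/-- Multiplying `ramF_one_four` by `ramF_two_three` evaluates `f(q, q^4) f(q^2, q^3)` in `k = u v^2`
and `ψ(q^5)^2`; insert this into `theta_sq_sub`. -/
theorem mul_theta_sq {q s t : ℂ} (ht : ‖t‖ < 1) (ht0 : t ≠ 0) (htq : t ^ 2 = q) (hs : s ^ 5 = q)
    {u v : ℂ} (hu : u = rogersRamanujan s q) (hv : v = rogersRamanujan (s ^ 2) (q ^ 2)) :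
    u * v ^ 2 * theta t t ^ 2
      = q * (1 + u * v ^ 2 - (u * v ^ 2) ^ 2) * theta (t ^ 5) (t ^ 5) ^ 2 := by
  have h1 := ramF_one_four ht ht0 htq hs hu hv
  have h2 := ramF_two_three ht ht0 htq hs hu hv
  have h3 := theta_sq_sub ht ht0 htq
  have h4 : 2 * ramF q (q ^ 4) * v * (2 * ramF (q ^ 2) (q ^ 3) * (u * v))
      = q * (1 - (u * v ^ 2) ^ 2) * theta (t ^ 5) (t ^ 5) ^ 2 := by
    rw [h1, h2, ← hs]; ring
  linear_combination u * v ^ 2 * h3 + h4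

/-- The quintic modular equation for `R(q) R(q^2)^2`. -/
theorem mul_sq_quintic {q s : ℂ} (hq : ‖q‖ < 1) (hq0 : q ≠ 0) (hs : s ^ 5 = q) {u v k U V D : ℂ}
    (hu : u = rogersRamanujan s q) (hv : v = rogersRamanujan (s ^ 2) (q ^ 2)) (hk : k = u * v ^ 2)
    (hU : U = rogersRamanujan (s ^ 5) (q ^ 5)) (hV : V = rogersRamanujan (s ^ 10) (q ^ 10))
    (hD : D = U * (1 + U * V ^ 2 - (U * V ^ 2) ^ 2)) :
    D ≠ 0 ∧ k * ((1 + U + U * V - U * V ^ 2 * (1 - U)) ^ 2 - D) = (1 - k ^ 2) * D := by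
  obtain ⟨t, htq⟩ := IsAlgClosed.exists_pow_nat_eq q two_pos
  have ht0 : t ≠ 0 := by rintro rfl; exact hq0 (by rw [← htq]; simp)
  have ht : ‖t‖ < 1 := by
    rw [← htq, norm_pow] at hq
    exact (pow_lt_one_iff_of_nonneg (norm_nonneg _) two_ne_zero).1 hq
  have hs0 : s ≠ 0 := by rintro rfl; exact hq0 (by rw [← hs]; simp)
  have hq5 := norm_pow_lt_one hq (by norm_num : 5 ≠ 0)
  have hq50 := pow_ne_zero 5 hq0
  have ht5 := norm_pow_lt_one ht (by norm_num : 5 ≠ 0)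
  have ht50 := pow_ne_zero 5 ht0
  have htq5 : (t ^ 5) ^ 2 = q ^ 5 := by rw [← htq]; ring
  have hs5 : (s ^ 5) ^ 5 = q ^ 5 := by rw [hs]
  have hV' : V = rogersRamanujan ((s ^ 5) ^ 2) ((q ^ 5) ^ 2) := by
    rw [hV, ← pow_mul, ← pow_mul]
  have hU0 : U ≠ 0 := hU ▸ rogersRamanujan_ne_zero (pow_ne_zero 5 hs0) hq5 hq50
  have hV0 : V ≠ 0 := hV ▸ rogersRamanujan_ne_zero (pow_ne_zero 10 hs0)
    (norm_pow_lt_one hq (by norm_num)) (pow_ne_zero 10 hq0)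
  have a1 := mul_theta_sq ht ht0 htq hs hu hv
  have a2 := mul_theta_sq ht5 ht50 htq5 hs5 hU hV'
  have a3 := ramF_one_four ht5 ht50 htq5 hs5 hU hV'
  have a4 := ramF_two_three ht5 ht50 htq5 hs5 hU hV'
  have a5 := theta_self_dissection ht ht0
  have t5 := theta_self_ne_zero ht5 ht50
  have t25 := theta_self_ne_zero (norm_pow_lt_one ht5 (by norm_num : 5 ≠ 0)) (pow_ne_zero 5 ht50)
  have e1 : ramF (t ^ 20) (t ^ 30) = ramF ((q ^ 5) ^ 2) ((q ^ 5) ^ 3) := by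
    rw [← htq]; congr 1 <;> ring
  have e2 : ramF (t ^ 10) (t ^ 40) = ramF (q ^ 5) ((q ^ 5) ^ 4) := by
    rw [← htq]; congr 1 <;> ring
  have e3 : t ^ 6 = q ^ 3 := by rw [← htq]; ring
  rw [e1, e2, e3, htq] at a5
  rw [hs] at a3 a4
  simp only [show (t ^ 5) ^ 5 = t ^ 25 by ring] at a2 a3 a4 t25
  generalize theta (t ^ 25) (t ^ 25) = c at *
  generalize theta (t ^ 5) (t ^ 5) = b at *
  generalize theta t t = a at *
  rw [← hk] at a1
  -- The dissection of `ψ(q)`, with both `f`-terms expressed through `ψ(q^25)`. Its square meets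
  -- `a1` and `a2`, which relate `ψ(q)^2`, `ψ(q^5)^2` and `ψ(q^25)^2`.
  have b1 : a * (U * V) = q ^ 3 * c * (1 + U + U * V - U * V ^ 2 * (1 - U)) := by
    linear_combination U * V * a5 + a4 + q * U * a3
  have hD0 : D ≠ 0 := by
    intro h
    rw [hD] at h
    have h' := (mul_eq_zero.1 h).resolve_left hU0
    rw [h'] at a2
    have : U * V ^ 2 * b ^ 2 ≠ 0 :=
      mul_ne_zero (mul_ne_zero hU0 (pow_ne_zero 2 hV0)) (pow_ne_zero 2 t5)
    exact this (by rw [a2]; ring)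
  refine ⟨hD0, ?_⟩
  have b2 : U * V ^ 2 * (q ^ 6 * c ^ 2) * (k * (1 + U + U * V - U * V ^ 2 * (1 - U)) ^ 2)
      = U * V ^ 2 * (q ^ 6 * c ^ 2) * ((1 + k - k ^ 2) * D) := by
    have : k * (a * (U * V)) ^ 2 = q * (1 + k - k ^ 2) * b ^ 2 * (U * V) ^ 2 := by
      linear_combination (U * V) ^ 2 * a1
    rw [b1] at this
    rw [hD]
    linear_combination U * V ^ 2 * this + q * (1 + k - k ^ 2) * (U * V) ^ 2 * a2
  have b3 := mul_left_cancel₀ (mul_ne_zero (mul_ne_zero hU0 (pow_ne_zero 2 hV0))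
    (mul_ne_zero (pow_ne_zero 6 hq0) (pow_ne_zero 2 t25))) b2
  linear_combination b3

/-! ### The three identities. -/

theorem corollary1p1 (q s : ℂ) (hq0 : q ≠ 0) (hq1 : ‖q‖ < 1) (hs : s ^ 5 = q)
    -- `R n` is `R(q^n)`, with the fifth root `s ^ n` of `q ^ n`
    (R : ℕ → ℂ) (hR : ∀ n, R n = rogersRamanujan (s ^ n) (q ^ n))
    -- `Rneg n` is `R(-q^n)`, with the fifth root `-(s ^ n)` of `-(q ^ n)`; used for `n = 1, 5`
    (Rneg : ℕ → ℂ) (hRneg : ∀ n, Rneg n = rogersRamanujan (-(s ^ n)) (-(q ^ n)))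
    (D N : ℂ)
    (hD : D = R 5 * (1 + R 5 * R 10 ^ 2 - R 5 ^ 2 * R 10 ^ 4))
    (hN : N = 1 + R 5 + R 5 ^ 2 + 2 * R 5 * R 10 + 2 * R 5 ^ 2 * R 10 - 2 * R 5 * R 10 ^ 2
      + 2 * R 5 ^ 3 * R 10 ^ 2 - 2 * R 5 ^ 2 * R 10 ^ 3 + 2 * R 5 ^ 3 * R 10 ^ 3
      + R 5 ^ 2 * R 10 ^ 4 - R 5 ^ 3 * R 10 ^ 4 + R 5 ^ 4 * R 10 ^ 4) :
    -- the continued fraction converges, to a nonzero value (`q` may be replaced by any `±q^n`)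
    (Filter.Tendsto (fun n : ℕ => (rogersRamanujanFract s q).convs n) Filter.atTop
        (nhds (rogersRamanujan s q)) ∧ rogersRamanujan s q ≠ 0) ∧
    (R 5 * R 10 - R 20 + R 5 * R 10 * R 20 ≠ 0 ∧
      R 4 ^ 2 / (R 1 * R 2)
        = R 20 * ((1 - R 5 * R 10 - R 20) / (R 5 * R 10 - R 20 + R 5 * R 10 * R 20))) ∧
    (1 - Rneg 5 - R 5 * Rneg 5 ≠ 0 ∧
      R 1 / Rneg 1 = -((1 - R 5 - R 5 * Rneg 5) / (1 - Rneg 5 - R 5 * Rneg 5))) ∧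
    (N ≠ 0 ∧ R 2 / R 1 ^ 2 - R 1 ^ 2 / R 2 = 4 * (D / N)) := by
  have hs0 : s ≠ 0 := by rintro rfl; exact hq0 (by rw [← hs]; simp)
  have hRn : ∀ n ≠ 0, R n ≠ 0 := fun n hn => by
    rw [hR]
    exact rogersRamanujan_ne_zero (pow_ne_zero n hs0) (norm_pow_lt_one hq1 hn) (pow_ne_zero n hq0)
  have hRnegn : ∀ n ≠ 0, Rneg n ≠ 0 := fun n hn => by
    rw [hRneg]
    exact rogersRamanujan_ne_zero (neg_ne_zero.2 (pow_ne_zero n hs0)) (norm_neg_pow_lt_one hq1 hn)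
      (neg_ne_zero.2 (pow_ne_zero n hq0))
  have r1 : R 1 = rogersRamanujan s q := by rw [hR, pow_one, pow_one]
  have w1 : Rneg 1 = rogersRamanujan (-s) (-q) := by rw [hRneg, pow_one, pow_one]
  have m1 : R 1 * Rneg 1 * R 2 = -R 4 := by
    rw [r1, w1, hR, hR]; exact rogersRamanujan_mul_neg s hq1 hq0
  have m5 : R 5 * Rneg 5 * R 10 = -R 20 := by
    have := rogersRamanujan_mul_neg (s ^ 5) (norm_pow_lt_one hq1 (by norm_num : 5 ≠ 0))
      (pow_ne_zero 5 hq0)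
    simp only [← pow_mul] at this
    rw [hR, hR, hR, hRneg]; exact this
  have n1 := hRn 1 (by norm_num)
  have n2 := hRn 2 (by norm_num)
  have n4 := hRn 4 (by norm_num)
  have n5 := hRn 5 (by norm_num)
  have n10 := hRn 10 (by norm_num)
  have n20 := hRn 20 (by norm_num)
  have nw1 := hRnegn 1 (by norm_num)
  have nw5 := hRnegn 5 (by norm_num)
  refine ⟨⟨?_, r1 ▸ n1⟩, ?_, ?_, ?_⟩
  · rw [rogersRamanujan_eq s hq0 hq1]
    exact tendsto_rogersRamanujanFract s hq0 hq1
  -- Taken at `-q` because `m1` makes the left side equal to `-R(-q)R(q^4)`; `m5` then removes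
  -- `R(-q^5)` from the result.
  · obtain ⟨h1, h2⟩ := mul_four_quintic (q := -q) (s := -s) (by rwa [norm_neg])
      (neg_ne_zero.2 hq0) (by rw [← hs]; ring) (z := Rneg 1 * R 4) (U := Rneg 5) (X := R 20)
      (by rw [w1, hR, show (-s) ^ 4 = s ^ 4 by ring, show (-q) ^ 4 = q ^ 4 by ring])
      (by rw [hRneg, show (-s) ^ 5 = -s ^ 5 by ring, show (-q) ^ 5 = -q ^ 5 by ring])
      (by rw [hR, show (-s) ^ 20 = s ^ 20 by ring, show (-q) ^ 20 = q ^ 20 by ring])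
    have e : R 5 * R 10 - R 20 + R 5 * R 10 * R 20
        = -(R 20 / Rneg 5) * (1 + Rneg 5 + R 20) := by
      field_simp
      linear_combination (1 + R 20) * m5
    have e0 : R 5 * R 10 - R 20 + R 5 * R 10 * R 20 ≠ 0 := by
      rw [e]; exact mul_ne_zero (neg_ne_zero.2 (div_ne_zero n20 nw5)) h1
    refine ⟨e0, ?_⟩
    have e2 : R 4 ^ 2 / (R 1 * R 2) = -(Rneg 1 * R 4) := by
      rw [div_eq_iff (mul_ne_zero n1 n2)]
      linear_combination R 4 * m1
    rw [e2, ← mul_div_assoc, eq_div_iff e0]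
    apply mul_left_cancel₀ nw5
    linear_combination (R 20 - Rneg 1 * R 4 * (1 + R 20)) * m5 + R 20 * h2
  · obtain ⟨h1, h2⟩ := div_neg_quintic hq1 hq0 hs r1 w1 (hR 5) (hRneg 5)
    refine ⟨h1, ?_⟩
    rw [← neg_div, div_eq_div_iff nw1 h1]
    linear_combination h2
  · obtain ⟨h1, h2⟩ := mul_sq_quintic hq1 hq0 hs r1 (hR 2) (k := R 1 * R 2 ^ 2) rfl (hR 5) (hR 10)
      (D := D) (by rw [hD]; ring)
    have hm := rogers_modular_equation hq1 hq0 hs r1 (hR 2)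
    -- The polynomial `N` is the expansion of `(1 + U + UV - UV^2(1 - U))^2 - D` with `U = R 5`, `V
    -- = R 10`.
    have hN' : R 1 * R 2 ^ 2 * N = (1 - (R 1 * R 2 ^ 2) ^ 2) * D := by
      rw [← h2, hN, hD]; ring
    have hk : 1 - R 1 * R 2 ^ 2 ≠ 0 := by
      intro h
      rw [h, zero_mul, eq_comm, mul_eq_zero, or_iff_left (pow_ne_zero 2 n1)] at hm
      exact two_ne_zero (α := ℂ) (by linear_combination h + hm)
    have hk' : 1 + R 1 * R 2 ^ 2 ≠ 0 := by
      intro h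
      rw [h, zero_mul] at hm
      exact mul_ne_zero hk n2 hm
    have hN0 : N ≠ 0 := by
      intro h
      rw [h, mul_zero] at hN'
      exact mul_ne_zero (by rw [show 1 - (R 1 * R 2 ^ 2) ^ 2 =
        (1 - R 1 * R 2 ^ 2) * (1 + R 1 * R 2 ^ 2) by ring]; exact mul_ne_zero hk hk') h1 hN'.symm
    refine ⟨hN0, ?_⟩
    have e1 : R 2 / R 1 ^ 2 = (1 + R 1 * R 2 ^ 2) / (1 - R 1 * R 2 ^ 2) := by
      rw [div_eq_div_iff (pow_ne_zero 2 n1) hk]; linear_combination hm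
    have e2 : R 1 ^ 2 / R 2 = (1 - R 1 * R 2 ^ 2) / (1 + R 1 * R 2 ^ 2) := by
      rw [div_eq_div_iff n2 hk']; linear_combination -hm
    have e3 : D / N = R 1 * R 2 ^ 2 / ((1 - R 1 * R 2 ^ 2) * (1 + R 1 * R 2 ^ 2)) := by
      rw [div_eq_div_iff hN0 (mul_ne_zero hk hk')]; linear_combination -hN'
    rw [e1, e2, e3]
    generalize R 1 * R 2 ^ 2 = k at *
    field_simp
    ring
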